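/- Let $(x_0,y_0)$ be the lower left corner of a rectangular domain $\Omega$ and let $R=[x_0,x_0+r]\times[y_0,y_0+s]\subset\overline\Omega$ ($r,s>0$) lie on one side of the interface, with $\{x_0\}\times(y_0,y_0+s)\subset\Gamma_1$ and $(x_0,x_0+r)\times\{y_0\}\subset\Gamma_3$. Consider near the corner $$-\nabla\cdot(a\nabla u)=f \text{ in } \operatorname{int}R,\qquad -u_x+\alpha u=g_1 \text{ on }\Gamma_1\cap R,\qquad -u_y=g_3\text{ on }\Gamma_3\cap R,$$ with $a>0$ on $R$. All derivatives below are taken at the corner: $v^{(m,n)}=\partial_x^m\partial_y^n v(x_0,y_0)$, $\alpha^{(n)},g_1^{(n)}$ at $y_0$, $g_3^{(n)}$ at $x_0$. Let $\Lambda_M=\{(m,n)\in\mathbb N_0^2: m+n\le M\}$, and let $h\to0^+$ (continuously, or along any family of mesh sizes tending to $0$). A 4-point scheme consists of functions $C_{k,\ell}(h)$, $k,\ell\in\{0,1\}$, not all tending to zero (that is, $\max_{k,\ell}|C_{k,\ell}(h)|\ge\delta>0$ for all small $h$), and of a right-hand side that is a linear combination, with $h$-dependent weights, of finitely many derivatives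 $f^{(m,n)},g_1^{(n)},g_3^{(n)}$. It is consistent of order $p$ if, for every sufficiently smooth solution $u$ with its data $f,g_1,g_3$, $$\sum_{k,\ell\in\{0,1\}}C_{k,\ell}(h)\,u(x_0+kh,y_0+\ell h)-(\text{right-hand side})=O(h^{p+1}).$$ Construction. Differentiating the equation at the corner expresses every $u^{(m,n)}$ linearly through the $u^{(0,j)}$, $u^{(1,j)}$ and $f^{(i,j)}$. Inserting this in the Taylor polynomial of degree 6 gives $$u(x_0+x,y_0+y)\approx\sum_{n=0}^{6}u^{(0,n)}G^V_{5,0,n}(x,y)+\sum_{n=0}^{5}u^{(1,n)}G^V_{5,1,n}(x,y)+\sum_{(m,n)\in\Lambda_4}f^{(m,n)}Q^V_{5,m,n}(x,y)$$ with polynomials $G^V,Q^V$ determined by the derivatives of $a$ at the corner. Substitute $u^{(1,n)}=\sum_{i\le n}\binom ni\alpha^{(n-i)}u^{(0,i)}-g_1^{(n)}$, and replace successively each $u^{(0,n)}$ with $n$ odd by its expression through $f^{(i,j)}$, $u^{(m,1)}=-g_3^{(m)}$ and $u^{(m,0)}$, $m<n$, obtained by solving the differentiated equation for derivatives in $y$,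 where the $u^{(m,0)}$ are in turn expressed through $f^{(i,j)}$, $g_1^{(j)}$ and the $u^{(0,j)}$, $j<n$. The result is an expansion $$\sum_{n\in\{0,2,4,6\}}u^{(0,n)}E_n+\sum_{(m,n)\in\Lambda_4}f^{(m,n)}F_{m,n}+\sum_{n=0}^5 g_1^{(n)}K^1_n+\sum_{n=0}^5 g_3^{(n)}K^3_n$$ with polynomials $E_n,F_{m,n},K^1_n,K^3_n$ in $(x,y)$ determined by $a$ and $\alpha$. For real numbers $c_{k,\ell,i}$ put $C_{k,\ell}(h)=\sum_{i=0}^6c_{k,\ell,i}h^i$ and consider the linear system $$\sum_{k,\ell\in\{0,1\}}C_{k,\ell}(h)\,E_n(kh,\ell h)=O(h^7),\qquad n=0,2,4,6.\tag{$*$}$$ Theorem. (1) Let $a\in C^6(R)$ and $\alpha\in C^5([y_0,y_0+s])$. Then $(*)$ has a solution with $c_{1,1,0}=1$. For every solution of $(*)$, the stencil coefficients $C_{k,\ell}(h)$ and the right-hand side $$\sum_{(m,n)\in\Lambda_4}f^{(m,n)}C_{f,m,n}+\sum_{n=0}^5g_1^{(n)}C_{g_1,n}+\sum_{n=0}^5g_3^{(n)}C_{g_3,n},$$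 where $C_{f,m,n}$, $C_{g_1,n}$, $C_{g_3,n}$ are $\sum_{k,\ell}C_{k,\ell}(h)P(kh,\ell h)$ with $P=F_{m,n},K^1_n,K^3_n$ respectively, leave a residual $O(h^7)$ for all $u\in C^7(R)$ with $f,g_1,g_3$ of class $C^5$ up to the boundary; if moreover some $c_{k,\ell,0}\ne0$, this is a 4-point scheme (the normalization above holds), consistent of order six. (2) Six is the largest $p$ such that for all $C^\infty$ coefficients $a>0$ and $\alpha$ there is a 4-point scheme consistent of order $p$ for all $C^\infty$ solutions. Moreover, for each constant $a>0$ and each constant $\alpha\ne0$, six is the largest order of a 4-point scheme for that problem. -/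

import Mathlib

open Set Filter Topology Asymptotics

noncomputable section

namespace CornerFD

/-! ### The elliptic problem near the lower left corner

`(x₀, y₀)` is the lower left corner of the domain and `[x₀, x₀ + r] × [y₀, y₀ + s]` is a closed
rectangle at this corner which is not crossed by the interface, so that the data and the solution
are smooth on it.  The side `{x₀} × (y₀, y₀ + s)` lies on `Γ₁` and the side
`(x₀, x₀ + r) × {y₀}` lies on `Γ₃`. -/

/-- The closed rectangle at the corner. -/
def rect (x₀ y₀ r s : ℝ) : Set (ℝ × ℝ) := Icc x₀ (x₀ + r) ×ˢ Icc y₀ (y₀ + s)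

/-- The coefficient `a` of the equation is positive and of class `C^(k+1)`, and the Robin
coefficient `α` on `Γ₁` is of class `C^k`, up to the boundary. -/
structure Coefficients (k : ℕ∞) (x₀ y₀ r s : ℝ) (a : ℝ × ℝ → ℝ) (α : ℝ → ℝ) : Prop where
  contDiffOn_a : ContDiffOn ℝ ((k + 1 : ℕ∞) : WithTop ℕ∞) a (rect x₀ y₀ r s)
  contDiffOn_α : ContDiffOn ℝ (k : WithTop ℕ∞) α (Icc y₀ (y₀ + s))
  a_pos : ∀ z ∈ rect x₀ y₀ r s, 0 < a z

/-- `u` is a solution with data `f`, `g₁`, `g₃`: `u` is of class `C^(k+2)` and the data are of class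
`C^k` up to the boundary, `-∇·(a∇u) = f` in the open rectangle, `∂u/∂n + αu = g₁` on `Γ₁` (where the
outward normal is `(-1, 0)`), and `∂u/∂n = g₃` on `Γ₃` (where the outward normal is `(0, -1)`). -/
structure Solution (k : ℕ∞) (x₀ y₀ r s : ℝ) (a : ℝ × ℝ → ℝ) (α : ℝ → ℝ)
    (u f : ℝ × ℝ → ℝ) (g₁ g₃ : ℝ → ℝ) : Prop where
  contDiffOn_u : ContDiffOn ℝ ((k + 2 : ℕ∞) : WithTop ℕ∞) u (rect x₀ y₀ r s)
  contDiffOn_f : ContDiffOn ℝ (k : WithTop ℕ∞) f (rect x₀ y₀ r s)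
  contDiffOn_g₁ : ContDiffOn ℝ (k : WithTop ℕ∞) g₁ (Icc y₀ (y₀ + s))
  contDiffOn_g₃ : ContDiffOn ℝ (k : WithTop ℕ∞) g₃ (Icc x₀ (x₀ + r))
  pde : ∀ x ∈ Ioo x₀ (x₀ + r), ∀ y ∈ Ioo y₀ (y₀ + s),
    -(deriv (fun t => a (t, y) * deriv (fun t' => u (t', y)) t) x
      + deriv (fun t => a (x, t) * deriv (fun t' => u (x, t')) t) y) = f (x, y)
  robin : ∀ y ∈ Ioo y₀ (y₀ + s),
    -derivWithin (fun t => u (t, y)) (Ici x₀) x₀ + α y * u (x₀, y) = g₁ y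
  neumann : ∀ x ∈ Ioo x₀ (x₀ + r),
    -derivWithin (fun t => u (x, t)) (Ici y₀) y₀ = g₃ x

/-- The one-sided derivative `g⁽ⁿ⁾` of a function of one variable at the left end point `t₀`. -/
def jet₁ (g : ℝ → ℝ) (t₀ : ℝ) (n : ℕ) : ℝ := iteratedDerivWithin n g (Ici t₀) t₀

/-- The partial derivative `v⁽ᵐ'ⁿ⁾ = ∂^(m+n) v / ∂x^m ∂y^n` at the corner `(x₀, y₀)`, taken from
inside the quadrant `x ≥ x₀`, `y ≥ y₀`. -/
def jet₂ (v : ℝ × ℝ → ℝ) (x₀ y₀ : ℝ) (m n : ℕ) : ℝ :=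
  iteratedDerivWithin m (fun x => iteratedDerivWithin n (fun y => v (x, y)) (Ici y₀) y₀)
    (Ici x₀) x₀

/-- The index set `Λ_M` of all `(m, n)` with `m + n ≤ M`. -/
def Lam (M : ℕ) : Finset (ℕ × ℕ) :=
  (Finset.range (M + 1) ×ˢ Finset.range (M + 1)).filter (fun p => p.1 + p.2 ≤ M)

/-! ### Four-point schemes -/

/-- A 4-point finite difference scheme at the corner: coefficients `C k ℓ h` of the values at
`(x₀ + kh, y₀ + ℓh)`, `k, ℓ ∈ {0, 1}`, and a right-hand side that is a linear combination of
derivatives of `f`, `g₁`, `g₃` at the corner up to some orders `Mf`, `M₁`, `M₃`. -/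
structure FourPointScheme where
  C : Fin 2 → Fin 2 → ℝ → ℝ
  Mf : ℕ
  Cf : ℕ → ℕ → ℝ → ℝ
  M₁ : ℕ
  Cg₁ : ℕ → ℝ → ℝ
  M₃ : ℕ
  Cg₃ : ℕ → ℝ → ℝ

namespace FourPointScheme

/-- The left-hand side of the scheme, applied to the exact solution. -/
def lhs (S : FourPointScheme) (x₀ y₀ : ℝ) (u : ℝ × ℝ → ℝ) (h : ℝ) : ℝ :=
  ∑ k : Fin 2, ∑ ℓ : Fin 2, S.C k ℓ h * u (x₀ + (k : ℕ) * h, y₀ + (ℓ : ℕ) * h)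

/-- The right-hand side of the scheme. -/
def rhs (S : FourPointScheme) (x₀ y₀ : ℝ) (f : ℝ × ℝ → ℝ) (g₁ g₃ : ℝ → ℝ) (h : ℝ) : ℝ :=
  ∑ p ∈ Lam S.Mf, jet₂ f x₀ y₀ p.1 p.2 * S.Cf p.1 p.2 h
    + ∑ n ∈ Finset.range (S.M₁ + 1), jet₁ g₁ y₀ n * S.Cg₁ n h
    + ∑ n ∈ Finset.range (S.M₃ + 1), jet₁ g₃ x₀ n * S.Cg₃ n h

/-- The scheme is normalized: the stencil coefficients do not all become small as `h → 0`
along `l`. -/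
def Nondegenerate (S : FourPointScheme) (l : Filter ℝ) : Prop :=
  ∃ δ > 0, ∀ᶠ h in l, ∃ k ℓ, δ ≤ |S.C k ℓ h|

/-- Consistency of order `p`: for every solution of class `C^(k+2)` with data of class `C^k`, the
residual is `O(h^(p+1))`.  The exponent is `p + 1`, since the stencil coefficients are of order `1`
and the boundary data, a first derivative of `u`, enter with weights of order `h`. -/
def Consistent (S : FourPointScheme) (k : ℕ∞) (l : Filter ℝ) (x₀ y₀ r s : ℝ) (a : ℝ × ℝ → ℝ)
    (α : ℝ → ℝ) (p : ℕ) : Prop :=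
  ∀ (u f : ℝ × ℝ → ℝ) (g₁ g₃ : ℝ → ℝ), Solution k x₀ y₀ r s a α u f g₁ g₃ →
    (fun h => S.lhs x₀ y₀ u h - S.rhs x₀ y₀ f g₁ g₃ h) =O[l] (fun h => h ^ (p + 1))

end FourPointScheme

/-- `p` is an accuracy order which some 4-point scheme for the problem with coefficients `a`, `α`
attains for all smooth (`C^∞`) solutions. -/
def AttainsOrder (l : Filter ℝ) (x₀ y₀ r s : ℝ) (a : ℝ × ℝ → ℝ) (α : ℝ → ℝ) (p : ℕ) : Prop :=
  ∃ S : FourPointScheme, S.Nondegenerate l ∧ S.Consistent ⊤ l x₀ y₀ r s a α p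

/-! ### The polynomials `G^V`, `Q^V` and their analogues in the other direction

Throughout, `A i j` stands for the derivative `a⁽ⁱ'ʲ⁾` at the corner. -/

/-- Differentiating `a (u_xx + u_yy) + a_x u_x + a_y u_y = -f` and solving for the highest
derivative in `x` determines all `u⁽ᵐ'ⁿ⁾` from `u⁽⁰'ⁿ⁾ = p n`, `u⁽¹'ⁿ⁾ = q n` and
`f⁽ᵐ'ⁿ⁾ = F m n`. -/
def vJet (A : ℕ → ℕ → ℝ) (p q : ℕ → ℝ) (F : ℕ → ℕ → ℝ) : ℕ → ℕ → ℝ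
  | 0, n => p n
  | 1, n => q n
  | m + 2, n =>
    -vJet A p q F m (n + 2)
      - (F m n
        + ∑ i : Fin (m + 1), ∑ j : Fin (n + 1), (m.choose i : ℝ) * (n.choose j : ℝ) *
          ((if _h : (i : ℕ) = 0 ∧ (j : ℕ) = 0 then 0
            else A i j * (vJet A p q F (m - i + 2) (n - j) + vJet A p q F (m - i) (n - j + 2)))
            + A (i + 1) j * vJet A p q F (m - i + 1) (n - j)
            + A i (j + 1) * vJet A p q F (m - i) (n - j + 1))) / A 0 0
termination_by m n => (m, n)
decreasing_by
  all_goals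
    try have hi := i.isLt
    try have hj := j.isLt
    simp only [Prod.lex_def]
    omega

/-- The same with the roles of `x` and `y` interchanged: all `u⁽ᵐ'ⁿ⁾` from `u⁽ᵐ'⁰⁾ = p m`,
`u⁽ᵐ'¹⁾ = q m` and `f⁽ᵐ'ⁿ⁾ = F m n`. -/
def hJet (A : ℕ → ℕ → ℝ) (p q : ℕ → ℝ) (F : ℕ → ℕ → ℝ) (m n : ℕ) : ℝ :=
  vJet (fun i j => A j i) p q (fun i j => F j i) n m

/-- The polynomial of degree `≤ d` with derivatives `J m n` at the origin. -/
def taylorPoly (d : ℕ) (J : ℕ → ℕ → ℝ) (x y : ℝ) : ℝ :=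
  ∑ p ∈ Lam d, J p.1 p.2 * x ^ p.1 * y ^ p.2 / ((p.1.factorial : ℝ) * (p.2.factorial : ℝ))

/-- `G^V_{M,m,n}` for `m ∈ {0, 1}`: the weight of `u⁽ᵐ'ⁿ⁾` in the expansion of `u` to degree
`M + 1`. -/
def GV (A : ℕ → ℕ → ℝ) (M m n : ℕ) : ℝ → ℝ → ℝ :=
  taylorPoly (M + 1) (vJet A (fun j => if m = 0 ∧ j = n then 1 else 0)
    (fun j => if m = 1 ∧ j = n then 1 else 0) (fun _ _ => 0))

/-- `Q^V_{M,m,n}`: the weight of `f⁽ᵐ'ⁿ⁾` in the expansion of `u` to degree `M + 1`. -/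
def QV (A : ℕ → ℕ → ℝ) (M m n : ℕ) : ℝ → ℝ → ℝ :=
  taylorPoly (M + 1) (vJet A (fun _ => 0) (fun _ => 0) (fun i j => if i = m ∧ j = n then 1 else 0))

/-! ### The corner construction

Here `al n = α⁽ⁿ⁾`, `F m n = f⁽ᵐ'ⁿ⁾`, `G₁ n = g₁⁽ⁿ⁾`, `G₃ n = g₃⁽ⁿ⁾`. -/

/-- The Robin condition `u_x = αu - g₁` on `Γ₁`: the derivative `u⁽¹'ⁿ⁾` in terms of the
`u⁽⁰'ⁱ⁾ = t i`. -/
def robinJet (al t G₁ : ℕ → ℝ) (n : ℕ) : ℝ :=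
  ∑ i ∈ Finset.range (n + 1), (n.choose i : ℝ) * al (n - i) * t i - G₁ n

/-- The derivatives `u⁽⁰'ⁿ⁾` in terms of those of even order, `e n`.  For odd `n`, the expansion in
the other direction together with the Neumann condition `u⁽ᵐ'¹⁾ = -g₃⁽ᵐ⁾` on `Γ₃` gives `u⁽⁰'ⁿ⁾`
from the `u⁽ᵐ'⁰⁾` with `m < n`, which depend only on the `u⁽⁰'ʲ⁾` with `j < n`. -/
def traceJet (A : ℕ → ℕ → ℝ) (al e : ℕ → ℝ) (F : ℕ → ℕ → ℝ) (G₁ G₃ : ℕ → ℝ) (n : ℕ) : ℝ :=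
  if Even n then e n
  else
    let t : ℕ → ℝ := fun j => if _h : j < n then traceJet A al e F G₁ G₃ j else 0
    hJet A (fun m => if m < n then vJet A t (robinJet al t G₁) F m 0 else 0) (fun m => -G₃ m) F 0 n
termination_by n

/-- The expansion of `u` at the corner, with `M = 5`, after both boundary conditions have been
inserted. -/
def cornerExpansion (A : ℕ → ℕ → ℝ) (al e : ℕ → ℝ) (F : ℕ → ℕ → ℝ) (G₁ G₃ : ℕ → ℝ)
    (x y : ℝ) : ℝ :=
  ∑ n ∈ Finset.range 7, traceJet A al e F G₁ G₃ n * GV A 5 0 n x y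
    + ∑ n ∈ Finset.range 6, robinJet al (traceJet A al e F G₁ G₃) G₁ n * GV A 5 1 n x y
    + ∑ p ∈ Lam 4, F p.1 p.2 * QV A 5 p.1 p.2 x y

/-- The weight of `u⁽⁰'ⁿ⁾`, `n` even, in the corner expansion. -/
def cornerE (A : ℕ → ℕ → ℝ) (al : ℕ → ℝ) (n : ℕ) : ℝ → ℝ → ℝ :=
  cornerExpansion A al (fun j => if j = n then 1 else 0) (fun _ _ => 0) (fun _ => 0) (fun _ => 0)

/-- The weight of `f⁽ᵐ'ⁿ⁾` in the corner expansion. -/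
def cornerF (A : ℕ → ℕ → ℝ) (al : ℕ → ℝ) (m n : ℕ) : ℝ → ℝ → ℝ :=
  cornerExpansion A al (fun _ => 0) (fun i j => if i = m ∧ j = n then 1 else 0) (fun _ => 0)
    (fun _ => 0)

/-- The weight of `g₁⁽ⁿ⁾` in the corner expansion. -/
def cornerG₁ (A : ℕ → ℕ → ℝ) (al : ℕ → ℝ) (n : ℕ) : ℝ → ℝ → ℝ :=
  cornerExpansion A al (fun _ => 0) (fun _ _ => 0) (fun j => if j = n then 1 else 0) (fun _ => 0)

/-- The weight of `g₃⁽ⁿ⁾` in the corner expansion. -/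
def cornerG₃ (A : ℕ → ℕ → ℝ) (al : ℕ → ℝ) (n : ℕ) : ℝ → ℝ → ℝ :=
  cornerExpansion A al (fun _ => 0) (fun _ _ => 0) (fun _ => 0) (fun j => if j = n then 1 else 0)

/-- `C_{k,ℓ}(h) = ∑_{i=0}^6 c_{k,ℓ,i} h^i`. -/
def polyC (c : Fin 2 → Fin 2 → Fin 7 → ℝ) (k ℓ : Fin 2) (h : ℝ) : ℝ :=
  ∑ i : Fin 7, c k ℓ i * h ^ (i : ℕ)

/-- `∑_{k,ℓ} C_{k,ℓ}(h) E(kh, ℓh)`. -/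
def stencilSum (c : Fin 2 → Fin 2 → Fin 7 → ℝ) (E : ℝ → ℝ → ℝ) (h : ℝ) : ℝ :=
  ∑ k : Fin 2, ∑ ℓ : Fin 2, polyC c k ℓ h * E ((k : ℕ) * h) ((ℓ : ℕ) * h)

/-- The linear system for the `c_{k,ℓ,i}`: the stencil annihilates, up to `O(h^7)`, the weights of
the derivatives `u⁽⁰'⁰⁾, u⁽⁰'²⁾, u⁽⁰'⁴⁾, u⁽⁰'⁶⁾` left free by the equation and the boundary
conditions. -/
def SolvesSystem (A : ℕ → ℕ → ℝ) (al : ℕ → ℝ) (c : Fin 2 → Fin 2 → Fin 7 → ℝ) : Prop :=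
  ∀ n ∈ ({0, 2, 4, 6} : Set ℕ), stencilSum c (cornerE A al n) =O[𝓝 0] (fun h => h ^ 7)

/-- The 4-point scheme with stencil coefficients `C_{k,ℓ}(h)`, whose right-hand side is
`∑_{Λ₄} f⁽ᵐ'ⁿ⁾ C_{f,m,n} + ∑_{n≤5} g₁⁽ⁿ⁾ C_{g₁,n} + ∑_{n≤5} g₃⁽ⁿ⁾ C_{g₃,n}`. -/
def cornerScheme (A : ℕ → ℕ → ℝ) (al : ℕ → ℝ) (c : Fin 2 → Fin 2 → Fin 7 → ℝ) :
    FourPointScheme where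
  C := polyC c
  Mf := 4
  Cf := fun m n => stencilSum c (cornerF A al m n)
  M₁ := 5
  Cg₁ := fun n => stencilSum c (cornerG₁ A al n)
  M₃ := 5
  Cg₃ := fun n => stencilSum c (cornerG₃ A al n)

end CornerFD

end

namespace CornerFD

/-! The differentiated equation determines the jet of `u` at the corner from `f` and the traces
u⁽⁰'ⁿ⁾, u⁽¹'ⁿ⁾. The Robin condition eliminates the u⁽¹'ⁿ⁾. The Neumann condition eliminates the
u⁽⁰'ⁿ⁾ with `n` odd: solved in the y-direction, the recursion lowers the order in y by two and ends
at the known u⁽ᵐ'¹⁾, up to terms of lower total order. Up to order 6 the jet is therefore a linear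
function of the data and of the four numbers u⁽⁰'ⁿ⁾, n = 0, 2, 4, 6. All of this rests on uniqueness
for the formal recursion, `vJet_eq_of_jetEq`, which yields linearity, the computed trace
(`traceJet_eq`) and the expansion `taylorPoly_eq_corner`. With Taylor's formula
(`taylor_remainder_bound`), a stencil that annihilates the four weights E_n up to O(h^7) is
consistent of order six.

Existence (`exists_solvesSystem`): the leading part of E_n is H_n = Re (y + ix)ⁿ / n!, whatever the
coefficients (`cornerE_eq`), so the condition for E_n may be divided by hⁿ. At the grid points
(0,1), (1,0), (1,1) the values of n! H_n are 1, -1, 0 for n = 2; 1, 1, -4 for n = 4; and again 1,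
-1, 0 for n = 6. With C₁₁ = 1, the conditions n = 2, 4 determine C₀₁ and C₁₀ modulo h^7, and n = 0
determines C₀₀. The condition n = 6 matters only at h = 0, where it repeats n = 2.

Barrier (`not_attainsOrder`): for constant `a` and α, the functions H_n + α ∫₀ˣ H_n solve the
homogeneous problem exactly, so the right-hand side of the scheme vanishes on them. Order seven
would require one more power of h in the condition n = 6. There the rows n = 2 and n = 6 differ by a
multiple of αh(4C₁₀ - 38C₁₁), while the other conditions force C₁₀ ≈ 2C₁₁. Hence all coefficients
tend to zero (`coefficients_small`), against the normalization. -/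

/-! ### The differentiated equation as a recursion for jets -/

/-- The contribution of `∂ⁱₓ∂ʲ_y a` and of its first derivatives to the equation
`a (u_xx + u_yy) + a_x u_x + a_y u_y = -f` differentiated `m` times in `x` and `n` times in `y`. -/
def jetTerm (A J : ℕ → ℕ → ℝ) (m n i j : ℕ) : ℝ :=
  A i j * (J (m - i + 2) (n - j) + J (m - i) (n - j + 2))
    + A (i + 1) j * J (m - i + 1) (n - j) + A i (j + 1) * J (m - i) (n - j + 1)

/-- The jet `J` satisfies the equation differentiated `m` times in `x` and `n` times in `y`. -/
def JetEq (A F J : ℕ → ℕ → ℝ) (m n : ℕ) : Prop :=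
  ∑ i ∈ Finset.range (m + 1), ∑ j ∈ Finset.range (n + 1),
    (m.choose i : ℝ) * (n.choose j : ℝ) * jetTerm A J m n i j = -F m n

lemma JetEq.swap {A F J : ℕ → ℕ → ℝ} {m n : ℕ} (h : JetEq A F J m n) :
    JetEq (fun i j => A j i) (fun i j => F j i) (fun i j => J j i) n m := by
  unfold JetEq at h ⊢
  rw [← h, Finset.sum_comm]
  refine Finset.sum_congr rfl fun i _ => Finset.sum_congr rfl fun j _ => ?_
  unfold jetTerm
  ring

lemma JetEq.lincomb {A F F' J J' : ℕ → ℕ → ℝ} {m n : ℕ} (b c : ℝ) (h : JetEq A F J m n)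
    (h' : JetEq A F' J' m n) :
    JetEq A (fun i j => b * F i j + c * F' i j) (fun i j => b * J i j + c * J' i j) m n := by
  unfold JetEq at h h' ⊢
  rw [neg_add, ← mul_neg, ← mul_neg, ← h, ← h', Finset.mul_sum, Finset.mul_sum,
    ← Finset.sum_add_distrib]
  refine Finset.sum_congr rfl fun i _ => ?_
  rw [Finset.mul_sum, Finset.mul_sum, ← Finset.sum_add_distrib]
  refine Finset.sum_congr rfl fun j _ => ?_
  unfold jetTerm
  ring

/-- The recursion for `vJet` leaves out the leading term i = j = 0, for which it is solved;
restoring it gives the full Leibniz sum of `JetEq`. -/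
lemma sum_lowerTerms (A J : ℕ → ℕ → ℝ) (m n : ℕ) :
    ∑ i ∈ Finset.range (m + 1), ∑ j ∈ Finset.range (n + 1),
        (m.choose i : ℝ) * (n.choose j : ℝ) *
          ((if i = 0 ∧ j = 0 then 0
            else A i j * (J (m - i + 2) (n - j) + J (m - i) (n - j + 2)))
            + A (i + 1) j * J (m - i + 1) (n - j)
            + A i (j + 1) * J (m - i) (n - j + 1))
      = ∑ i ∈ Finset.range (m + 1), ∑ j ∈ Finset.range (n + 1),
          (m.choose i : ℝ) * (n.choose j : ℝ) * jetTerm A J m n i j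
        - A 0 0 * (J (m + 2) n + J m (n + 2)) := by
  have key : A 0 0 * (J (m + 2) n + J m (n + 2)) =
      ∑ i ∈ Finset.range (m + 1), ∑ j ∈ Finset.range (n + 1),
        if i = 0 ∧ j = 0 then A 0 0 * (J (m + 2) n + J m (n + 2)) else 0 := by
    rw [Finset.sum_eq_single 0, Finset.sum_eq_single 0] <;> simp +contextual
  rw [key, ← Finset.sum_sub_distrib]
  refine Finset.sum_congr rfl fun i _ => ?_
  rw [← Finset.sum_sub_distrib]
  refine Finset.sum_congr rfl fun j _ => ?_
  unfold jetTerm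
  split_ifs with h
  · obtain ⟨rfl, rfl⟩ := h
    simp
    ring
  · ring

lemma vJet_add_two (A : ℕ → ℕ → ℝ) (p q : ℕ → ℝ) (F : ℕ → ℕ → ℝ) (m n : ℕ) :
    vJet A p q F (m + 2) n = -vJet A p q F m (n + 2) - (F m n +
      ∑ i ∈ Finset.range (m + 1), ∑ j ∈ Finset.range (n + 1),
        (m.choose i : ℝ) * (n.choose j : ℝ) *
          ((if i = 0 ∧ j = 0 then 0
            else A i j * (vJet A p q F (m - i + 2) (n - j) + vJet A p q F (m - i) (n - j + 2)))
            + A (i + 1) j * vJet A p q F (m - i + 1) (n - j)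
            + A i (j + 1) * vJet A p q F (m - i) (n - j + 1))) / A 0 0 := by
  rw [vJet, Finset.sum_range]
  simp only [Finset.sum_range, dite_eq_ite]

lemma vJet_zero (A : ℕ → ℕ → ℝ) (p q : ℕ → ℝ) (F : ℕ → ℕ → ℝ) (n : ℕ) :
    vJet A p q F 0 n = p n := by rw [vJet]

lemma vJet_one (A : ℕ → ℕ → ℝ) (p q : ℕ → ℝ) (F : ℕ → ℕ → ℝ) (n : ℕ) :
    vJet A p q F 1 n = q n := by rw [vJet]

lemma jetEq_vJet {A : ℕ → ℕ → ℝ} (hA : A 0 0 ≠ 0) (p q : ℕ → ℝ) (F : ℕ → ℕ → ℝ) (m n : ℕ) :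
    JetEq A F (vJet A p q F) m n := by
  have h := vJet_add_two A p q F m n
  rw [sum_lowerTerms] at h
  unfold JetEq
  field_simp at h
  linarith

/-- Uniqueness for the recursion up to total order `N`.  The value `p N` influences only the
derivatives of order `N` that are of even order in `x`. -/
lemma vJet_eq_of_jetEq {A F F' J : ℕ → ℕ → ℝ} {p q : ℕ → ℝ} {N : ℕ} (hA : A 0 0 ≠ 0)
    (hJ : ∀ m n, m + n + 2 ≤ N → JetEq A F J m n)
    (hF : ∀ m n, m + n + 2 ≤ N → F' m n = F m n)
    (hp : ∀ n < N, p n = J 0 n) (hq : ∀ n, n + 1 ≤ N → q n = J 1 n) (m n : ℕ) (hmn : m + n ≤ N)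
    (hN : p N = J 0 N ∨ m + n < N ∨ Odd m) : vJet A p q F' m n = J m n := by
  induction m using Nat.strong_induction_on generalizing n with
  | _ m IHm =>
  induction n using Nat.strong_induction_on with
  | _ n IHn =>
  match m, IHm, IHn, hmn, hN with
  | 0, IHm, IHn, hmn, hN =>
    rw [vJet_zero]
    rcases lt_or_eq_of_le hmn with h | h
    · exact hp _ (by omega)
    · have : n = N := by omega
      subst this
      simpa using hN
  | 1, IHm, IHn, hmn, hN =>
    rw [vJet_one]
    exact hq _ (by omega)
  | m + 2, IHm, IHn, hmn, hN =>
    -- The step from `m + 2` to `m` preserves both the total order and the parity of `m`, so each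
    -- alternative of `hN` is inherited. All other terms have total order below `N` and never see `p
    -- N`.
    have e1 : vJet A p q F' m (n + 2) = J m (n + 2) :=
      IHm m (by omega) (n + 2) (by omega)
        (by rcases hN with h | h | h
            · exact Or.inl h
            · exact Or.inr (Or.inl (by omega))
            · exact Or.inr (Or.inr (by simpa [Nat.odd_add] using h)))
    have e2 := sum_lowerTerms A J m n
    have e3 := hJ m n (by omega)
    unfold JetEq at e3
    rw [vJet_add_two, e1, hF m n (by omega)]
    rw [e3] at e2
    have e4 : J (m + 2) n = -J m (n + 2) - (F m n + (-F m n - A 0 0 * (J (m + 2) n + J m (n + 2))))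
        / A 0 0 := by
      field_simp
      ring
    rw [e4, ← e2]
    congr 3
    refine Finset.sum_congr rfl fun i hi => Finset.sum_congr rfl fun j hj => ?_
    have hi := Finset.mem_range.1 hi
    have hj := Finset.mem_range.1 hj
    have a1 : vJet A p q F' (m - i + 1) (n - j) = J (m - i + 1) (n - j) :=
      IHm _ (by omega) _ (by omega) (Or.inr (Or.inl (by omega)))
    have a2 : vJet A p q F' (m - i) (n - j + 1) = J (m - i) (n - j + 1) :=
      IHm _ (by omega) _ (by omega) (Or.inr (Or.inl (by omega)))
    rw [a1, a2]
    split_ifs with h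
    · rfl
    · have a3 : vJet A p q F' (m - i) (n - j + 2) = J (m - i) (n - j + 2) :=
        IHm _ (by omega) _ (by omega) (Or.inr (Or.inl (by omega)))
      -- For i = 0 the order in x is still `m + 2`, but then j > 0, so the inner induction on `n`
      -- applies.
      have a4 : vJet A p q F' (m - i + 2) (n - j) = J (m - i + 2) (n - j) := by
        rcases Nat.eq_zero_or_pos i with rfl | hi0
        · exact IHn _ (by omega) (by omega) (Or.inr (Or.inl (by omega)))
        · exact IHm _ (by omega) _ (by omega) (Or.inr (Or.inl (by omega)))
      rw [a3, a4]

/-! ### Linearity -/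

/-- By uniqueness: the combination of the two jets satisfies the equation for the combined data. -/
lemma vJet_lincomb {A : ℕ → ℕ → ℝ} (hA : A 0 0 ≠ 0) (b c : ℝ) (p p' q q' : ℕ → ℝ)
    (F F' : ℕ → ℕ → ℝ) (m n : ℕ) :
    vJet A (fun j => b * p j + c * p' j) (fun j => b * q j + c * q' j)
        (fun i j => b * F i j + c * F' i j) m n
      = b * vJet A p q F m n + c * vJet A p' q' F' m n := by
  refine vJet_eq_of_jetEq (N := m + n) (J := fun m n => b * vJet A p q F m n +
    c * vJet A p' q' F' m n) hA (fun i j _ =>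
      (jetEq_vJet hA p q F i j).lincomb b c (jetEq_vJet hA p' q' F' i j)) (fun _ _ _ => rfl)
      ?_ ?_ m n le_rfl (Or.inl ?_) <;> simp [vJet_zero, vJet_one]

lemma robinJet_lincomb (al : ℕ → ℝ) (b c : ℝ) (t t' G G' : ℕ → ℝ) (n : ℕ) :
    robinJet al (fun j => b * t j + c * t' j) (fun j => b * G j + c * G' j) n
      = b * robinJet al t G n + c * robinJet al t' G' n := by
  unfold robinJet
  rw [mul_sub, mul_sub, Finset.mul_sum, Finset.mul_sum]
  have : ∀ x y z w : ℝ, x - y + (z - w) = (x + z) - (y + w) := by intros; ring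
  rw [this, ← Finset.sum_add_distrib]
  congr 1
  refine Finset.sum_congr rfl fun i _ => ?_
  ring

lemma traceJet_lincomb {A : ℕ → ℕ → ℝ} (hA : A 0 0 ≠ 0) (al : ℕ → ℝ) (b c : ℝ) (e e' : ℕ → ℝ)
    (F F' : ℕ → ℕ → ℝ) (G₁ G₁' G₃ G₃' : ℕ → ℝ) (n : ℕ) :
    traceJet A al (fun j => b * e j + c * e' j) (fun i j => b * F i j + c * F' i j)
        (fun j => b * G₁ j + c * G₁' j) (fun j => b * G₃ j + c * G₃' j) n
      = b * traceJet A al e F G₁ G₃ n + c * traceJet A al e' F' G₁' G₃' n := by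
  induction n using Nat.strong_induction_on with
  | _ n IH =>
  rw [traceJet, traceJet, traceJet]
  split_ifs with hn
  · rfl
  · simp only [hJet]
    rw [← vJet_lincomb (by exact hA)]
    congr 1
    · funext m
      split_ifs with hm
      · rw [← vJet_lincomb hA]
        simp_rw [← robinJet_lincomb]
        congr 1
        · funext j
          split_ifs with hj
          · exact IH j hj
          · simp
        · funext j
          congr 1
          funext j
          split_ifs with hj
          · exact IH j hj
          · simp
      · simp
    · funext m
      ring

lemma taylorPoly_lincomb (d : ℕ) (b c : ℝ) (J J' : ℕ → ℕ → ℝ) (x y : ℝ) :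
    taylorPoly d (fun i j => b * J i j + c * J' i j) x y
      = b * taylorPoly d J x y + c * taylorPoly d J' x y := by
  unfold taylorPoly
  rw [Finset.mul_sum, Finset.mul_sum, ← Finset.sum_add_distrib]
  refine Finset.sum_congr rfl fun i _ => ?_
  ring

/-- The Taylor polynomial of `vJet` as a linear function of the data `(p, q, F)`. -/
noncomputable def vTaylor (A : ℕ → ℕ → ℝ) (hA : A 0 0 ≠ 0) (d : ℕ) (x y : ℝ) :
    (ℕ → ℝ) × (ℕ → ℝ) × (ℕ → ℕ → ℝ) →ₗ[ℝ] ℝ where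
  toFun D := taylorPoly d (vJet A D.1 D.2.1 D.2.2) x y
  map_add' D D' := by
    have h := taylorPoly_lincomb d 1 1 (vJet A D.1 D.2.1 D.2.2) (vJet A D'.1 D'.2.1 D'.2.2) x y
    simp_rw [← vJet_lincomb hA, one_mul] at h
    exact h
  map_smul' b D := by
    have h := taylorPoly_lincomb d b 0 (vJet A D.1 D.2.1 D.2.2) (vJet A D.1 D.2.1 D.2.2) x y
    simp_rw [← vJet_lincomb hA, zero_mul, add_zero] at h
    exact h

lemma cornerExpansion_lincomb {A : ℕ → ℕ → ℝ} (hA : A 0 0 ≠ 0) (al : ℕ → ℝ) (b c : ℝ)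
    (e e' : ℕ → ℝ) (F F' : ℕ → ℕ → ℝ) (G₁ G₁' G₃ G₃' : ℕ → ℝ) (x y : ℝ) :
    cornerExpansion A al (fun j => b * e j + c * e' j) (fun i j => b * F i j + c * F' i j)
        (fun j => b * G₁ j + c * G₁' j) (fun j => b * G₃ j + c * G₃' j) x y
      = b * cornerExpansion A al e F G₁ G₃ x y + c * cornerExpansion A al e' F' G₁' G₃' x y := by
  unfold cornerExpansion
  have ht : traceJet A al (fun j => b * e j + c * e' j) (fun i j => b * F i j + c * F' i j)
        (fun j => b * G₁ j + c * G₁' j) (fun j => b * G₃ j + c * G₃' j)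
      = fun n => b * traceJet A al e F G₁ G₃ n + c * traceJet A al e' F' G₁' G₃' n :=
    funext fun n => traceJet_lincomb hA al b c e e' F F' G₁ G₁' G₃ G₃' n
  rw [ht]
  simp only [robinJet_lincomb, add_mul, Finset.sum_add_distrib, mul_add, Finset.mul_sum, mul_assoc]
  ring

/-- The corner expansion as a linear function of `(e, F, G₁, G₃)`. -/
noncomputable def cornerLinear (A : ℕ → ℕ → ℝ) (hA : A 0 0 ≠ 0) (al : ℕ → ℝ) (x y : ℝ) :
    (ℕ → ℝ) × (ℕ → ℕ → ℝ) × (ℕ → ℝ) × (ℕ → ℝ) →ₗ[ℝ] ℝ where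
  toFun D := cornerExpansion A al D.1 D.2.1 D.2.2.1 D.2.2.2 x y
  map_add' D D' := by
    have h := cornerExpansion_lincomb hA al 1 1 D.1 D'.1 D.2.1 D'.2.1 D.2.2.1 D'.2.2.1
      D.2.2.2 D'.2.2.2 x y
    simp_rw [one_mul] at h
    exact h
  map_smul' b D := by
    have h := cornerExpansion_lincomb hA al b 0 D.1 D.1 D.2.1 D.2.1 D.2.2.1 D.2.2.1
      D.2.2.2 D.2.2.2 x y
    simp_rw [zero_mul, add_zero] at h
    exact h

/-! ### The corner expansion of a jet -/

lemma mem_Lam {M : ℕ} {p : ℕ × ℕ} : p ∈ Lam M ↔ p.1 + p.2 ≤ M := by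
  simp only [Lam, Finset.mem_filter, Finset.mem_product, Finset.mem_range]
  omega

/-- The corner expansion is the Taylor polynomial of the jet determined by its trace. -/
lemma cornerExpansion_eq_taylorPoly {A : ℕ → ℕ → ℝ} (hA : A 0 0 ≠ 0) (al e : ℕ → ℝ)
    (F : ℕ → ℕ → ℝ) (G₁ G₃ : ℕ → ℝ) (x y : ℝ) :
    cornerExpansion A al e F G₁ G₃ x y = taylorPoly 6 (vJet A (traceJet A al e F G₁ G₃)
      (robinJet al (traceJet A al e F G₁ G₃) G₁) F) x y := by
  set t := traceJet A al e F G₁ G₃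
  set q := robinJet al t G₁
  -- By linearity the expansion is the Taylor polynomial belonging to data cut off beyond order 6;
  -- what remains is that the cut-off is invisible in that degree.
  have h : cornerExpansion A al e F G₁ G₃ x y = vTaylor A hA 6 x y
      (∑ n ∈ Finset.range 7, t n • ((fun j => if j = n then 1 else 0), 0, 0)
        + ∑ n ∈ Finset.range 6, q n • (0, (fun j => if j = n then 1 else 0), 0)
        + ∑ p ∈ Lam 4, F p.1 p.2 • (0, 0, fun i j => if i = p.1 ∧ j = p.2 then 1 else 0)) := by
    simp only [map_add, map_sum, map_smul, smul_eq_mul]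
    simp only [vTaylor, LinearMap.coe_mk, AddHom.coe_mk]
    simp [cornerExpansion, GV, QV, t, q]
    rfl
  rw [h]
  simp only [vTaylor, LinearMap.coe_mk, AddHom.coe_mk]
  unfold taylorPoly
  refine Finset.sum_congr rfl fun p hp => ?_
  have hp := mem_Lam.1 hp
  congr 3
  refine vJet_eq_of_jetEq (N := 6) hA (fun m n _ => jetEq_vJet hA t q F m n) ?_ ?_ ?_ _ _ hp
    (Or.inl ?_)
  · intro m n hmn
    simp only [Prod.snd_add, Prod.snd_sum, Prod.smul_snd, Pi.add_apply, Finset.sum_apply,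
      Pi.smul_apply, smul_eq_mul, Pi.zero_apply, mul_zero, Finset.sum_const_zero, zero_add]
    rw [Finset.sum_eq_single (m, n)]
    · simp
    · rintro ⟨i, j⟩ _ hne
      rw [if_neg, mul_zero]
      rintro ⟨rfl, rfl⟩
      exact hne rfl
    · intro hn
      exact absurd (mem_Lam.2 (by simp; omega)) hn
  · intro n hn
    simp [Prod.fst_sum, vJet_zero, hn.trans (by norm_num : 6 < 7)]
  · intro n hn
    simp [Prod.fst_sum, Prod.snd_sum, vJet_one]
    intro h
    omega
  · simp [Prod.fst_sum, vJet_zero]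

/-- A jet that satisfies the differentiated equation and the differentiated boundary conditions
has the trace which the corner construction computes. -/
lemma traceJet_eq {A F J : ℕ → ℕ → ℝ} {al e G₁ G₃ : ℕ → ℝ} {N : ℕ} (hA : A 0 0 ≠ 0)
    (hJ : ∀ m n, m + n + 2 ≤ N → JetEq A F J m n)
    (hR : ∀ n, n + 1 ≤ N → robinJet al (J 0) G₁ n = J 1 n)
    (hG : ∀ m, m + 1 ≤ N → -G₃ m = J m 1)
    (he : ∀ n ≤ N, Even n → e n = J 0 n) (n : ℕ) (hn : n ≤ N) :
    traceJet A al e F G₁ G₃ n = J 0 n := by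
  induction n using Nat.strong_induction_on with
  | _ n IH =>
  rw [traceJet]
  split_ifs with hev
  · exact he n hn hev
  · refine vJet_eq_of_jetEq (A := fun i j => A j i) (F := fun i j => F j i) (N := n)
      (J := fun i j => J j i) hA
      (fun i j hij => (hJ j i (by omega)).swap) (fun _ _ _ => rfl) ?_ ?_ n 0 (by omega)
      (Or.inr (Or.inr (Nat.not_even_iff_odd.1 hev)))
    · intro m hm
      simp only [hm, if_true]
      have ht : ∀ j < n, (if _h : j < n then traceJet A al e F G₁ G₃ j else 0) = J 0 j := by
        intro j hj
        rw [dif_pos hj]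
        exact IH j hj (by omega)
      -- u⁽ᵐ'⁰⁾ involves traces of order at most m < n only, so the zeros put in for j ≥ n do no
      -- harm.
      refine vJet_eq_of_jetEq (N := m) hA (fun i j hij => hJ i j (by omega)) (fun _ _ _ => rfl)
        (fun j hj => ht j (by omega)) ?_ m 0 (by omega) (Or.inl (ht m hm))
      intro j hj
      rw [← hR j (by omega)]
      unfold robinJet
      congr 1
      refine Finset.sum_congr rfl fun i hi => ?_
      have := Finset.mem_range.1 hi
      dsimp only
      rw [ht i (by omega)]
    · intro m hm
      exact hG m (by omega)

lemma robinJet_congr {al t t' G G' : ℕ → ℝ} {n : ℕ} (ht : ∀ i ≤ n, t i = t' i) (hG : G n = G' n) :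
    robinJet al t G n = robinJet al t' G' n := by
  unfold robinJet
  rw [hG]
  congr 1
  refine Finset.sum_congr rfl fun i hi => ?_
  rw [ht i (by have := Finset.mem_range.1 hi; omega)]

lemma JetEq.congr {A F F' J : ℕ → ℕ → ℝ} {m n : ℕ} (h : JetEq A F J m n) (hF : F' m n = F m n) :
    JetEq A F' J m n := by
  unfold JetEq at h ⊢
  rw [h, hF]

/-- The expansion at the corner of a jet that satisfies the differentiated equation and the
differentiated boundary conditions. -/
theorem taylorPoly_eq_corner {A F J : ℕ → ℕ → ℝ} {al G₁ G₃ : ℕ → ℝ} (hA : A 0 0 ≠ 0)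
    (hJ : ∀ m n, m + n + 2 ≤ 6 → JetEq A F J m n)
    (hR : ∀ n, n + 1 ≤ 6 → robinJet al (J 0) G₁ n = J 1 n)
    (hG : ∀ m, m + 1 ≤ 6 → -G₃ m = J m 1) (x y : ℝ) :
    taylorPoly 6 J x y = ∑ n ∈ ({0, 2, 4, 6} : Finset ℕ), J 0 n * cornerE A al n x y
      + (∑ p ∈ Lam 4, F p.1 p.2 * cornerF A al p.1 p.2 x y
        + ∑ n ∈ Finset.range 6, G₁ n * cornerG₁ A al n x y
        + ∑ n ∈ Finset.range 6, G₃ n * cornerG₃ A al n x y) := by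
  set δ : ℕ → ℕ → ℝ := fun n j => if j = n then 1 else 0 with hδ
  -- The superposition of unit data whose weights make up the right-hand side. Its trace entries of
  -- odd order are zero, which is harmless because `traceJet` reads them only at even orders.
  set D : (ℕ → ℝ) × (ℕ → ℕ → ℝ) × (ℕ → ℝ) × (ℕ → ℝ) :=
    ∑ n ∈ ({0, 2, 4, 6} : Finset ℕ), J 0 n • (δ n, 0, 0, 0)
      + (∑ p ∈ Lam 4, F p.1 p.2 • (0, (fun i j => if i = p.1 ∧ j = p.2 then 1 else 0), 0, 0)
        + ∑ n ∈ Finset.range 6, G₁ n • (0, 0, δ n, 0)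
        + ∑ n ∈ Finset.range 6, G₃ n • (0, 0, 0, δ n)) with hD
  have h : cornerLinear A hA al x y D = ∑ n ∈ ({0, 2, 4, 6} : Finset ℕ), J 0 n * cornerE A al n x y
      + (∑ p ∈ Lam 4, F p.1 p.2 * cornerF A al p.1 p.2 x y
        + ∑ n ∈ Finset.range 6, G₁ n * cornerG₁ A al n x y
        + ∑ n ∈ Finset.range 6, G₃ n * cornerG₃ A al n x y) := by
    rw [hD]
    simp only [map_add, map_sum, map_smul, smul_eq_mul]
    rfl
  rw [← h]
  have hF : ∀ m n, m + n + 2 ≤ 6 → D.2.1 m n = F m n := by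
    intro m n hmn
    rw [hD]
    simp only [Prod.snd_add, Prod.snd_sum, Prod.smul_snd, Prod.fst_add, Prod.fst_sum,
      Prod.smul_fst, Pi.add_apply, Finset.sum_apply,
      Pi.smul_apply, smul_eq_mul, Pi.zero_apply, mul_zero, Finset.sum_const_zero, zero_add,
      add_zero]
    rw [Finset.sum_eq_single (m, n)]
    · simp
    · rintro ⟨i, j⟩ _ hne
      rw [if_neg, mul_zero]
      rintro ⟨rfl, rfl⟩
      exact hne rfl
    · intro hn
      exact absurd (mem_Lam.2 (by simp; omega)) hn
  have hG1 : ∀ n, n + 1 ≤ 6 → D.2.2.1 n = G₁ n := by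
    intro n hn
    rw [hD]
    simp [Prod.fst_sum, Prod.snd_sum, hδ]
    intro h
    omega
  have hG3 : ∀ n, n + 1 ≤ 6 → D.2.2.2 n = G₃ n := by
    intro n hn
    rw [hD]
    simp [Prod.snd_sum, hδ]
    intro h
    omega
  have he : ∀ n ≤ 6, Even n → D.1 n = J 0 n := by
    intro n hn hev
    rw [hD]
    interval_cases n <;> simp_all (decide := true) [Prod.fst_sum, Prod.snd_sum]
  have hR' : ∀ n, n + 1 ≤ 6 → robinJet al (J 0) D.2.2.1 n = J 1 n := fun n hn => by
    rw [← hR n hn]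
    exact robinJet_congr (fun _ _ => rfl) (hG1 n hn)
  have hJ' : ∀ m n, m + n + 2 ≤ 6 → JetEq A D.2.1 J m n := fun m n hmn =>
    (hJ m n hmn).congr (hF m n hmn)
  have ht := traceJet_eq (e := D.1) (G₃ := D.2.2.2) hA hJ' hR'
    (fun m hm => by rw [hG3 m hm, hG m hm]) he
  simp only [cornerLinear, LinearMap.coe_mk, AddHom.coe_mk]
  rw [cornerExpansion_eq_taylorPoly hA]
  unfold taylorPoly
  refine Finset.sum_congr rfl fun p hp => ?_
  have hp := mem_Lam.1 hp
  congr 3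
  refine (vJet_eq_of_jetEq (N := 6) hA hJ' (fun _ _ _ => rfl) (fun n hn => ht n hn.le) ?_ _ _ hp
    (Or.inl (ht 6 le_rfl))).symm
  intro n hn
  rw [← hR' n hn]
  exact robinJet_congr (fun i hi => ht i (by omega)) rfl

/-! ### Partial derivatives on the closed rectangle -/

/-- The partial derivative in `x` within the set `R`. -/
noncomputable def dx (R : Set (ℝ × ℝ)) (v : ℝ × ℝ → ℝ) (z : ℝ × ℝ) : ℝ :=
  fderivWithin ℝ v R z (1, 0)

/-- The partial derivative in `y` within the set `R`. -/
noncomputable def dy (R : Set (ℝ × ℝ)) (v : ℝ × ℝ → ℝ) (z : ℝ × ℝ) : ℝ :=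
  fderivWithin ℝ v R z (0, 1)

section Partial

variable {x₀ y₀ r s : ℝ}

lemma interior_rect : interior (rect x₀ y₀ r s) = Ioo x₀ (x₀ + r) ×ˢ Ioo y₀ (y₀ + s) := by
  rw [rect, interior_prod_eq, interior_Icc, interior_Icc]

lemma closure_Ioo_prod (hr : 0 < r) (hs : 0 < s) :
    closure (Ioo x₀ (x₀ + r) ×ˢ Ioo y₀ (y₀ + s)) = rect x₀ y₀ r s := by
  rw [closure_prod_eq, closure_Ioo (by linarith), closure_Ioo (by linarith), rect]

lemma rect_subset_closure_interior (hr : 0 < r) (hs : 0 < s) :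
    rect x₀ y₀ r s ⊆ closure (interior (rect x₀ y₀ r s)) := by
  rw [interior_rect, closure_Ioo_prod hr hs]

lemma uniqueDiffOn_rect (hr : 0 < r) (hs : 0 < s) : UniqueDiffOn ℝ (rect x₀ y₀ r s) :=
  (uniqueDiffOn_Icc (by linarith)).prod (uniqueDiffOn_Icc (by linarith))

lemma corner_mem (hr : 0 < r) (hs : 0 < s) : (x₀, y₀) ∈ rect x₀ y₀ r s :=
  ⟨⟨le_rfl, by simpa using hr.le⟩, ⟨le_rfl, by simpa using hs.le⟩⟩

variable {v w : ℝ × ℝ → ℝ}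

lemma contDiffOn_fderivWithin_apply (hr : 0 < r) (hs : 0 < s) {n : ℕ} (e : ℝ × ℝ)
    (hv : ContDiffOn ℝ ((n + 1 : ℕ) : WithTop ℕ∞) v (rect x₀ y₀ r s)) :
    ContDiffOn ℝ (n : WithTop ℕ∞) (fun z => fderivWithin ℝ v (rect x₀ y₀ r s) z e)
      (rect x₀ y₀ r s) :=
  (hv.fderivWithin (uniqueDiffOn_rect hr hs) (by norm_cast)).clm_apply contDiffOn_const

lemma contDiffOn_dx (hr : 0 < r) (hs : 0 < s) {n : ℕ}
    (hv : ContDiffOn ℝ ((n + 1 : ℕ) : WithTop ℕ∞) v (rect x₀ y₀ r s)) :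
    ContDiffOn ℝ (n : WithTop ℕ∞) (dx (rect x₀ y₀ r s) v) (rect x₀ y₀ r s) :=
  contDiffOn_fderivWithin_apply hr hs (1, 0) hv

lemma contDiffOn_dy (hr : 0 < r) (hs : 0 < s) {n : ℕ}
    (hv : ContDiffOn ℝ ((n + 1 : ℕ) : WithTop ℕ∞) v (rect x₀ y₀ r s)) :
    ContDiffOn ℝ (n : WithTop ℕ∞) (dy (rect x₀ y₀ r s) v) (rect x₀ y₀ r s) :=
  contDiffOn_fderivWithin_apply hr hs (0, 1) hv

lemma dx_congr {R : Set (ℝ × ℝ)} (h : EqOn v w R) : EqOn (dx R v) (dx R w) R := fun z hz => by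
  unfold dx
  rw [fderivWithin_congr h (h hz)]

lemma dy_congr {R : Set (ℝ × ℝ)} (h : EqOn v w R) : EqOn (dy R v) (dy R w) R := fun z hz => by
  unfold dy
  rw [fderivWithin_congr h (h hz)]

lemma dx_iterate_congr {R : Set (ℝ × ℝ)} (h : EqOn v w R) (m : ℕ) :
    EqOn ((dx R)^[m] v) ((dx R)^[m] w) R := by
  induction m with
  | zero => exact h
  | succ m IH =>
    rw [Function.iterate_succ_apply', Function.iterate_succ_apply']
    exact dx_congr IH

lemma contDiffOn_dx_iterate (hr : 0 < r) (hs : 0 < s) {n : ℕ} (m : ℕ)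
    (hv : ContDiffOn ℝ ((n + m : ℕ) : WithTop ℕ∞) v (rect x₀ y₀ r s)) :
    ContDiffOn ℝ (n : WithTop ℕ∞) ((dx (rect x₀ y₀ r s))^[m] v) (rect x₀ y₀ r s) := by
  induction m generalizing n with
  | zero => exact hv
  | succ m IH =>
    rw [Function.iterate_succ_apply']
    exact contDiffOn_dx hr hs (IH (by rwa [add_assoc, add_comm 1 m]))

lemma contDiffOn_dy_iterate (hr : 0 < r) (hs : 0 < s) {n : ℕ} (m : ℕ)
    (hv : ContDiffOn ℝ ((n + m : ℕ) : WithTop ℕ∞) v (rect x₀ y₀ r s)) :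
    ContDiffOn ℝ (n : WithTop ℕ∞) ((dy (rect x₀ y₀ r s))^[m] v) (rect x₀ y₀ r s) := by
  induction m generalizing n with
  | zero => exact hv
  | succ m IH =>
    rw [Function.iterate_succ_apply']
    exact contDiffOn_dy hr hs (IH (by rwa [add_assoc, add_comm 1 m]))

/-- Symmetry of the second derivative persists at boundary points because the rectangle lies in the
closure of its interior. -/
lemma dx_dy_comm (hr : 0 < r) (hs : 0 < s)
    (hv : ContDiffOn ℝ ((2 : ℕ) : WithTop ℕ∞) v (rect x₀ y₀ r s)) :
    EqOn (dx (rect x₀ y₀ r s) (dy (rect x₀ y₀ r s) v))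
      (dy (rect x₀ y₀ r s) (dx (rect x₀ y₀ r s) v)) (rect x₀ y₀ r s) := by
  intro z hz
  have hU := uniqueDiffOn_rect (x₀ := x₀) (y₀ := y₀) hr hs
  have h1 : DifferentiableWithinAt ℝ (fderivWithin ℝ v (rect x₀ y₀ r s)) (rect x₀ y₀ r s) z :=
    ((hv.fderivWithin (m := 1) hU (by norm_cast)).differentiableOn (by norm_num)) z hz
  have h2 := (hv z hz).isSymmSndFDerivWithinAt (by simp) hU
    (rect_subset_closure_interior hr hs hz) hz
  unfold dx dy
  rw [fderivWithin_clm_apply (hU z hz) h1 (differentiableWithinAt_const _),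
    fderivWithin_clm_apply (hU z hz) h1 (differentiableWithinAt_const _)]
  simpa using h2 _ _

/-- `jet₂` differentiates in y first; this moves an inner x-derivative outward into that order. -/
lemma dy_iterate_dx_comm (hr : 0 < r) (hs : 0 < s) (n : ℕ)
    (hv : ContDiffOn ℝ ((n + 1 : ℕ) : WithTop ℕ∞) v (rect x₀ y₀ r s)) :
    EqOn ((dy (rect x₀ y₀ r s))^[n] (dx (rect x₀ y₀ r s) v))
      (dx (rect x₀ y₀ r s) ((dy (rect x₀ y₀ r s))^[n] v)) (rect x₀ y₀ r s) := by
  induction n with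
  | zero => exact fun _ _ => rfl
  | succ n IH =>
    rw [Function.iterate_succ_apply', Function.iterate_succ_apply']
    refine (dy_congr (IH (hv.of_le (by norm_cast; omega)))).trans
      (dx_dy_comm hr hs (contDiffOn_dy_iterate hr hs n ?_)).symm
    rwa [show 2 + n = n + 1 + 1 by omega]

lemma hasDerivWithinAt_dx {R : Set (ℝ × ℝ)} {S : Set ℝ} {x y : ℝ}
    (hv : DifferentiableWithinAt ℝ v R (x, y)) (hS : ∀ t ∈ S, (t, y) ∈ R) :
    HasDerivWithinAt (fun t => v (t, y)) (dx R v (x, y)) S x := by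
  have h1 : HasDerivWithinAt (fun t : ℝ => (t, y)) ((1 : ℝ), (0 : ℝ)) S x :=
    (hasDerivWithinAt_id x S).prodMk (hasDerivWithinAt_const x S y)
  exact hv.hasFDerivWithinAt.comp_hasDerivWithinAt x h1 hS

lemma hasDerivWithinAt_dy {R : Set (ℝ × ℝ)} {S : Set ℝ} {x y : ℝ}
    (hv : DifferentiableWithinAt ℝ v R (x, y)) (hS : ∀ t ∈ S, (x, t) ∈ R) :
    HasDerivWithinAt (fun t => v (x, t)) (dy R v (x, y)) S y := by
  have h1 : HasDerivWithinAt (fun t : ℝ => (x, t)) ((0 : ℝ), (1 : ℝ)) S y :=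
    (hasDerivWithinAt_const y S x).prodMk (hasDerivWithinAt_id y S)
  exact hv.hasFDerivWithinAt.comp_hasDerivWithinAt y h1 hS

lemma contDiffOn_slice_x {n : WithTop ℕ∞} {y : ℝ} (hy : y ∈ Icc y₀ (y₀ + s))
    (hv : ContDiffOn ℝ n v (rect x₀ y₀ r s)) :
    ContDiffOn ℝ n (fun t => v (t, y)) (Icc x₀ (x₀ + r)) :=
  hv.comp (contDiff_id.prodMk contDiff_const).contDiffOn fun _ ht => ⟨ht, hy⟩

lemma contDiffOn_slice_y {n : WithTop ℕ∞} {x : ℝ} (hx : x ∈ Icc x₀ (x₀ + r))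
    (hv : ContDiffOn ℝ n v (rect x₀ y₀ r s)) :
    ContDiffOn ℝ n (fun t => v (x, t)) (Icc y₀ (y₀ + s)) :=
  hv.comp (contDiff_const.prodMk contDiff_id).contDiffOn fun _ ht => ⟨hx, ht⟩

lemma iteratedDerivWithin_slice_y (hr : 0 < r) (hs : 0 < s) {n : ℕ}
    (hv : ContDiffOn ℝ (n : WithTop ℕ∞) v (rect x₀ y₀ r s)) {x y : ℝ}
    (hx : x ∈ Icc x₀ (x₀ + r)) (hy : y ∈ Icc y₀ (y₀ + s)) :
    iteratedDerivWithin n (fun t => v (x, t)) (Icc y₀ (y₀ + s)) y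
      = (dy (rect x₀ y₀ r s))^[n] v (x, y) := by
  induction n generalizing y with
  | zero => simp
  | succ n IH =>
    rw [iteratedDerivWithin_succ, Function.iterate_succ_apply',
      derivWithin_congr (f := fun t => (dy (rect x₀ y₀ r s))^[n] v (x, t))
        (fun t ht => IH (hv.of_le (by norm_cast; omega)) ht)
        (IH (hv.of_le (by norm_cast; omega)) hy)]
    have hd : DifferentiableWithinAt ℝ ((dy (rect x₀ y₀ r s))^[n] v) (rect x₀ y₀ r s) (x, y) :=
      (contDiffOn_dy_iterate hr hs (n := 1) n (by rwa [add_comm])).differentiableOn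
        (by norm_num) _ ⟨hx, hy⟩
    exact (hasDerivWithinAt_dy hd fun t ht => ⟨hx, ht⟩).derivWithin
      (uniqueDiffOn_Icc (by linarith) y hy)

lemma iteratedDerivWithin_slice_x (hr : 0 < r) (hs : 0 < s) {n : ℕ}
    (hv : ContDiffOn ℝ (n : WithTop ℕ∞) v (rect x₀ y₀ r s)) {x y : ℝ}
    (hx : x ∈ Icc x₀ (x₀ + r)) (hy : y ∈ Icc y₀ (y₀ + s)) :
    iteratedDerivWithin n (fun t => v (t, y)) (Icc x₀ (x₀ + r)) x
      = (dx (rect x₀ y₀ r s))^[n] v (x, y) := by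
  induction n generalizing x with
  | zero => simp
  | succ n IH =>
    rw [iteratedDerivWithin_succ, Function.iterate_succ_apply',
      derivWithin_congr (f := fun t => (dx (rect x₀ y₀ r s))^[n] v (t, y))
        (fun t ht => IH (hv.of_le (by norm_cast; omega)) ht)
        (IH (hv.of_le (by norm_cast; omega)) hx)]
    have hd : DifferentiableWithinAt ℝ ((dx (rect x₀ y₀ r s))^[n] v) (rect x₀ y₀ r s) (x, y) :=
      (contDiffOn_dx_iterate hr hs (n := 1) n (by rwa [add_comm])).differentiableOn
        (by norm_num) _ ⟨hx, hy⟩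
    exact (hasDerivWithinAt_dx hd fun t ht => ⟨ht, hy⟩).derivWithin
      (uniqueDiffOn_Icc (by linarith) x hx)

lemma Icc_eventuallyEq_Ici {t₀ : ℝ} (hs : 0 < s) : Icc t₀ (t₀ + s) =ᶠ[𝓝 t₀] Ici t₀ := by
  filter_upwards [Iio_mem_nhds (show t₀ < t₀ + s by linarith)] with t ht
  exact propext ⟨fun h => h.1, fun h => ⟨h, le_of_lt ht⟩⟩

/-- Derivatives within a set depend only on its germ at the point. This passes from the quadrant in
the definition of the jets to the rectangle, where smoothness is assumed. -/
lemma iteratedDerivWithin_Ici_eq {t₀ : ℝ} (hs : 0 < s) (n : ℕ) (g : ℝ → ℝ) :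
    iteratedDerivWithin n g (Ici t₀) t₀ = iteratedDerivWithin n g (Icc t₀ (t₀ + s)) t₀ := by
  unfold iteratedDerivWithin
  rw [iteratedFDerivWithin_congr_set (Icc_eventuallyEq_Ici hs)]

lemma jet₂_eq_Icc (hr : 0 < r) (hs : 0 < s) (v : ℝ × ℝ → ℝ) (m n : ℕ) :
    jet₂ v x₀ y₀ m n = iteratedDerivWithin m (fun x => iteratedDerivWithin n (fun y => v (x, y))
      (Icc y₀ (y₀ + s)) y₀) (Icc x₀ (x₀ + r)) x₀ := by
  simp only [jet₂, iteratedDerivWithin_Ici_eq (t₀ := x₀) hr, iteratedDerivWithin_Ici_eq (t₀ := y₀) hs]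

/-- The jet at the corner in terms of the partial derivatives on the rectangle. -/
lemma jet₂_eq (hr : 0 < r) (hs : 0 < s) (m n : ℕ)
    (hv : ContDiffOn ℝ ((m + n : ℕ) : WithTop ℕ∞) v (rect x₀ y₀ r s)) :
    jet₂ v x₀ y₀ m n = (dx (rect x₀ y₀ r s))^[m] ((dy (rect x₀ y₀ r s))^[n] v) (x₀, y₀) := by
  have hy : y₀ ∈ Icc y₀ (y₀ + s) := ⟨le_rfl, by linarith⟩
  have hx : x₀ ∈ Icc x₀ (x₀ + r) := ⟨le_rfl, by linarith⟩
  rw [jet₂_eq_Icc hr hs]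
  rw [← iteratedDerivWithin_slice_x hr hs (contDiffOn_dy_iterate hr hs n hv) hx hy]
  refine iteratedDerivWithin_congr (fun t ht => ?_) hx
  exact iteratedDerivWithin_slice_y hr hs (hv.of_le (by norm_cast; omega)) ht hy

lemma jet₂_congr (hr : 0 < r) (hs : 0 < s) (h : EqOn v w (rect x₀ y₀ r s)) (m n : ℕ) :
    jet₂ v x₀ y₀ m n = jet₂ w x₀ y₀ m n := by
  have hy : y₀ ∈ Icc y₀ (y₀ + s) := ⟨le_rfl, by linarith⟩
  have hx : x₀ ∈ Icc x₀ (x₀ + r) := ⟨le_rfl, by linarith⟩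
  rw [jet₂_eq_Icc hr hs, jet₂_eq_Icc hr hs]
  refine iteratedDerivWithin_congr (fun t ht => ?_) hx
  exact iteratedDerivWithin_congr (fun t' ht' => h ⟨ht, ht'⟩) hy

lemma jet₂_dx (hr : 0 < r) (hs : 0 < s) (m n : ℕ)
    (hv : ContDiffOn ℝ ((m + n + 1 : ℕ) : WithTop ℕ∞) v (rect x₀ y₀ r s)) :
    jet₂ (dx (rect x₀ y₀ r s) v) x₀ y₀ m n = jet₂ v x₀ y₀ (m + 1) n := by
  rw [jet₂_eq hr hs m n (contDiffOn_dx hr hs hv),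
    jet₂_eq hr hs (m + 1) n (by rwa [show m + 1 + n = m + n + 1 by omega]),
    Function.iterate_succ_apply]
  exact dx_iterate_congr (dy_iterate_dx_comm hr hs n (hv.of_le (by norm_cast; omega))) m
    (corner_mem hr hs)

lemma jet₂_dy (hr : 0 < r) (hs : 0 < s) (m n : ℕ)
    (hv : ContDiffOn ℝ ((m + n + 1 : ℕ) : WithTop ℕ∞) v (rect x₀ y₀ r s)) :
    jet₂ (dy (rect x₀ y₀ r s) v) x₀ y₀ m n = jet₂ v x₀ y₀ m (n + 1) := by
  rw [jet₂_eq hr hs m n (contDiffOn_dy hr hs hv), jet₂_eq hr hs m (n + 1) hv,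
    Function.iterate_succ_apply]

lemma jet₂_add (hr : 0 < r) (hs : 0 < s) (m n : ℕ)
    (hv : ContDiffOn ℝ ((m + n : ℕ) : WithTop ℕ∞) v (rect x₀ y₀ r s))
    (hw : ContDiffOn ℝ ((m + n : ℕ) : WithTop ℕ∞) w (rect x₀ y₀ r s)) :
    jet₂ (fun z => v z + w z) x₀ y₀ m n = jet₂ v x₀ y₀ m n + jet₂ w x₀ y₀ m n := by
  have hy : y₀ ∈ Icc y₀ (y₀ + s) := ⟨le_rfl, by linarith⟩
  have hx : x₀ ∈ Icc x₀ (x₀ + r) := ⟨le_rfl, by linarith⟩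
  have hUx : UniqueDiffOn ℝ (Icc x₀ (x₀ + r)) := uniqueDiffOn_Icc (by linarith)
  have hUy : UniqueDiffOn ℝ (Icc y₀ (y₀ + s)) := uniqueDiffOn_Icc (by linarith)
  rw [jet₂_eq hr hs m n hv, jet₂_eq hr hs m n hw,
    ← iteratedDerivWithin_slice_x hr hs (contDiffOn_dy_iterate hr hs n hv) hx hy,
    ← iteratedDerivWithin_slice_x hr hs (contDiffOn_dy_iterate hr hs n hw) hx hy,
    ← iteratedDerivWithin_fun_add hx hUx
      (contDiffOn_slice_x hy (contDiffOn_dy_iterate hr hs n hv) _ hx)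
      (contDiffOn_slice_x hy (contDiffOn_dy_iterate hr hs n hw) _ hx)]
  rw [jet₂_eq_Icc hr hs]
  refine iteratedDerivWithin_congr (fun t ht => ?_) hx
  have hv' : ContDiffOn ℝ (n : WithTop ℕ∞) v (rect x₀ y₀ r s) := hv.of_le (by norm_cast; omega)
  have hw' : ContDiffOn ℝ (n : WithTop ℕ∞) w (rect x₀ y₀ r s) := hw.of_le (by norm_cast; omega)
  rw [iteratedDerivWithin_fun_add hy hUy (contDiffOn_slice_y ht hv' _ hy)
    (contDiffOn_slice_y ht hw' _ hy),
    iteratedDerivWithin_slice_y hr hs hv' ht hy, iteratedDerivWithin_slice_y hr hs hw' ht hy]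

lemma jet₂_neg (v : ℝ × ℝ → ℝ) (x₀ y₀ : ℝ) (m n : ℕ) :
    jet₂ (fun z => -v z) x₀ y₀ m n = -jet₂ v x₀ y₀ m n := by
  unfold jet₂
  simp only [iteratedDerivWithin_fun_neg]

/-- The Leibniz rule at the corner. -/
lemma jet₂_mul (hr : 0 < r) (hs : 0 < s) (m n : ℕ)
    (hv : ContDiffOn ℝ ((m + n : ℕ) : WithTop ℕ∞) v (rect x₀ y₀ r s))
    (hw : ContDiffOn ℝ ((m + n : ℕ) : WithTop ℕ∞) w (rect x₀ y₀ r s)) :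
    jet₂ (fun z => v z * w z) x₀ y₀ m n
      = ∑ i ∈ Finset.range (m + 1), ∑ j ∈ Finset.range (n + 1),
        (m.choose i : ℝ) * (n.choose j : ℝ) *
          (jet₂ v x₀ y₀ i j * jet₂ w x₀ y₀ (m - i) (n - j)) := by
  have hy : y₀ ∈ Icc y₀ (y₀ + s) := ⟨le_rfl, by linarith⟩
  have hx : x₀ ∈ Icc x₀ (x₀ + r) := ⟨le_rfl, by linarith⟩
  have hUx : UniqueDiffOn ℝ (Icc x₀ (x₀ + r)) := uniqueDiffOn_Icc (by linarith)
  have hUy : UniqueDiffOn ℝ (Icc y₀ (y₀ + s)) := uniqueDiffOn_Icc (by linarith)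
  set R := rect x₀ y₀ r s
  have hP : ∀ {v' : ℝ × ℝ → ℝ}, ContDiffOn ℝ ((m + n : ℕ) : WithTop ℕ∞) v' R → ∀ j ≤ n,
      ContDiffOn ℝ (m : WithTop ℕ∞) ((dy R)^[j] v') R := fun h j hj =>
    contDiffOn_dy_iterate hr hs j (h.of_le (by norm_cast; omega))
  -- The one-variable Leibniz rule in y on each vertical slice; the same rule in x is then applied
  -- to each summand.
  have e1 : jet₂ (fun z => v z * w z) x₀ y₀ m n = iteratedDerivWithin m (fun x =>
      ∑ j ∈ Finset.range (n + 1), (n.choose j : ℝ) *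
        (((fun t => (dy R)^[j] v (t, y₀)) * fun t => (dy R)^[n - j] w (t, y₀)) x))
      (Icc x₀ (x₀ + r)) x₀ := by
    rw [jet₂_eq_Icc hr hs]
    refine iteratedDerivWithin_congr (fun t ht => ?_) hx
    have hv' : ContDiffOn ℝ (n : WithTop ℕ∞) v (rect x₀ y₀ r s) := hv.of_le (by norm_cast; omega)
    have hw' : ContDiffOn ℝ (n : WithTop ℕ∞) w (rect x₀ y₀ r s) := hw.of_le (by norm_cast; omega)
    refine (iteratedDerivWithin_mul hy hUy (contDiffOn_slice_y ht hv' _ hy)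
      (contDiffOn_slice_y ht hw' _ hy)).trans (Finset.sum_congr rfl fun j hj => ?_)
    have hj := Finset.mem_range.1 hj
    rw [iteratedDerivWithin_slice_y hr hs (hv.of_le (by norm_cast; omega)) ht hy,
      iteratedDerivWithin_slice_y hr hs (hw.of_le (by norm_cast; omega)) ht hy, Pi.mul_apply,
      mul_assoc]
  rw [e1, iteratedDerivWithin_fun_sum hx hUx, Finset.sum_comm]
  · refine Finset.sum_congr rfl fun j hj => ?_
    have hj := Finset.mem_range.1 hj
    rw [iteratedDerivWithin_const_mul_field, iteratedDerivWithin_mul hx hUx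
      (contDiffOn_slice_x hy (hP hv j (by omega)) _ hx)
      (contDiffOn_slice_x hy (hP hw (n - j) (by omega)) _ hx), Finset.mul_sum]
    refine Finset.sum_congr rfl fun i hi => ?_
    have hi := Finset.mem_range.1 hi
    rw [iteratedDerivWithin_slice_x hr hs ((hP hv j (by omega)).of_le (by norm_cast; omega)) hx hy,
      iteratedDerivWithin_slice_x hr hs ((hP hw (n - j) (by omega)).of_le (by norm_cast; omega))
        hx hy, jet₂_eq hr hs i j (hv.of_le (by norm_cast; omega)),
      jet₂_eq hr hs (m - i) (n - j) (hw.of_le (by norm_cast; omega))]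
    ring
  · intro j hj
    have hj := Finset.mem_range.1 hj
    exact contDiffWithinAt_const.mul ((contDiffOn_slice_x hy (hP hv j (by omega)) _ hx).mul
      (contDiffOn_slice_x hy (hP hw (n - j) (by omega)) _ hx))

end Partial

/-! ### The jet of a solution -/

section Solution

variable {x₀ y₀ r s : ℝ} {a u f : ℝ × ℝ → ℝ} {α g₁ g₃ : ℝ → ℝ}

lemma Coefficients.mono {k k' : ℕ∞} (h : k' ≤ k) (hc : Coefficients k x₀ y₀ r s a α) :
    Coefficients k' x₀ y₀ r s a α :=
  ⟨hc.contDiffOn_a.of_le (by exact_mod_cast add_le_add_left h 1),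
    hc.contDiffOn_α.of_le (by exact_mod_cast h), hc.a_pos⟩

lemma Solution.mono {k k' : ℕ∞} (h : k' ≤ k) (hu : Solution k x₀ y₀ r s a α u f g₁ g₃) :
    Solution k' x₀ y₀ r s a α u f g₁ g₃ where
  contDiffOn_u := hu.contDiffOn_u.of_le (by exact_mod_cast add_le_add_left h 2)
  contDiffOn_f := hu.contDiffOn_f.of_le (by exact_mod_cast h)
  contDiffOn_g₁ := hu.contDiffOn_g₁.of_le (by exact_mod_cast h)
  contDiffOn_g₃ := hu.contDiffOn_g₃.of_le (by exact_mod_cast h)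
  pde := hu.pde
  robin := hu.robin
  neumann := hu.neumann

lemma deriv_eq_dx {v : ℝ × ℝ → ℝ} {x y : ℝ} (hv : ContDiffOn ℝ ((1 : ℕ) : WithTop ℕ∞) v
    (rect x₀ y₀ r s)) (hx : x ∈ Ioo x₀ (x₀ + r)) (hy : y ∈ Ioo y₀ (y₀ + s)) :
    deriv (fun t => v (t, y)) x = dx (rect x₀ y₀ r s) v (x, y) := by
  have hd : DifferentiableWithinAt ℝ v (rect x₀ y₀ r s) (x, y) :=
    hv.differentiableOn (by norm_num) _ ⟨Ioo_subset_Icc_self hx, Ioo_subset_Icc_self hy⟩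
  exact ((hasDerivWithinAt_dx (S := Icc x₀ (x₀ + r)) hd fun t ht =>
    ⟨ht, Ioo_subset_Icc_self hy⟩).hasDerivAt (Icc_mem_nhds hx.1 hx.2)).deriv

lemma deriv_eq_dy {v : ℝ × ℝ → ℝ} {x y : ℝ} (hv : ContDiffOn ℝ ((1 : ℕ) : WithTop ℕ∞) v
    (rect x₀ y₀ r s)) (hx : x ∈ Ioo x₀ (x₀ + r)) (hy : y ∈ Ioo y₀ (y₀ + s)) :
    deriv (fun t => v (x, t)) y = dy (rect x₀ y₀ r s) v (x, y) := by
  have hd : DifferentiableWithinAt ℝ v (rect x₀ y₀ r s) (x, y) :=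
    hv.differentiableOn (by norm_num) _ ⟨Ioo_subset_Icc_self hx, Ioo_subset_Icc_self hy⟩
  exact ((hasDerivWithinAt_dy (S := Icc y₀ (y₀ + s)) hd fun t ht =>
    ⟨Ioo_subset_Icc_self hx, ht⟩).hasDerivAt (Icc_mem_nhds hy.1 hy.2)).deriv

/-- The equation holds up to the boundary of the rectangle. -/
lemma Solution.pde_on_rect (hr : 0 < r) (hs : 0 < s)
    (ha : ContDiffOn ℝ ((6 : ℕ) : WithTop ℕ∞) a (rect x₀ y₀ r s))
    (hu : ContDiffOn ℝ ((7 : ℕ) : WithTop ℕ∞) u (rect x₀ y₀ r s))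
    (h : Solution 5 x₀ y₀ r s a α u f g₁ g₃) :
    EqOn (fun z => (a z * dx (rect x₀ y₀ r s) (dx (rect x₀ y₀ r s) u) z
        + a z * dy (rect x₀ y₀ r s) (dy (rect x₀ y₀ r s) u) z)
        + (dx (rect x₀ y₀ r s) a z * dx (rect x₀ y₀ r s) u z
        + dy (rect x₀ y₀ r s) a z * dy (rect x₀ y₀ r s) u z)) (fun z => -f z)
      (rect x₀ y₀ r s) := by
  set R := rect x₀ y₀ r s with hR
  have hux := contDiffOn_dx hr hs hu
  have huy := contDiffOn_dy hr hs hu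
  -- Both sides are continuous on the closed rectangle, so it suffices to compare them on the dense
  -- open one.
  refine EqOn.of_subset_closure (s := Ioo x₀ (x₀ + r) ×ˢ Ioo y₀ (y₀ + s)) ?_ ?_
    h.contDiffOn_f.continuousOn.neg
    (prod_mono Ioo_subset_Icc_self Ioo_subset_Icc_self) (closure_Ioo_prod hr hs).ge
  · rintro ⟨x, y⟩ ⟨hx, hy⟩
    have hz : (x, y) ∈ R := ⟨Ioo_subset_Icc_self hx, Ioo_subset_Icc_self hy⟩
    have hp := h.pde x hx y hy
    have e1 : deriv (fun t => a (t, y) * deriv (fun t' => u (t', y)) t) x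
        = dx R a (x, y) * dx R u (x, y) + a (x, y) * dx R (dx R u) (x, y) := by
      have hd : DifferentiableWithinAt ℝ a R (x, y) := ha.differentiableOn (by norm_num) _ hz
      have hd' : DifferentiableWithinAt ℝ (dx R u) R (x, y) :=
        hux.differentiableOn (by norm_num) _ hz
      have h1 := (hasDerivWithinAt_dx (S := Ioo x₀ (x₀ + r)) hd fun t ht =>
        ⟨Ioo_subset_Icc_self ht, hz.2⟩).hasDerivAt (Ioo_mem_nhds hx.1 hx.2)
      have h2 := (hasDerivWithinAt_dx (S := Ioo x₀ (x₀ + r)) hd' fun t ht =>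
        ⟨Ioo_subset_Icc_self ht, hz.2⟩).hasDerivAt (Ioo_mem_nhds hx.1 hx.2)
      have h3 : (fun t => a (t, y) * deriv (fun t' => u (t', y)) t) =ᶠ[𝓝 x]
          fun t => a (t, y) * dx R u (t, y) := by
        filter_upwards [Ioo_mem_nhds hx.1 hx.2] with t ht
        rw [deriv_eq_dx (hu.of_le (by norm_cast)) ht hy]
      rw [h3.deriv_eq]
      exact (h1.mul h2).deriv
    have e2 : deriv (fun t => a (x, t) * deriv (fun t' => u (x, t')) t) y
        = dy R a (x, y) * dy R u (x, y) + a (x, y) * dy R (dy R u) (x, y) := by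
      have hd : DifferentiableWithinAt ℝ a R (x, y) := ha.differentiableOn (by norm_num) _ hz
      have hd' : DifferentiableWithinAt ℝ (dy R u) R (x, y) :=
        huy.differentiableOn (by norm_num) _ hz
      have h1 := (hasDerivWithinAt_dy (S := Ioo y₀ (y₀ + s)) hd fun t ht =>
        ⟨hz.1, Ioo_subset_Icc_self ht⟩).hasDerivAt (Ioo_mem_nhds hy.1 hy.2)
      have h2 := (hasDerivWithinAt_dy (S := Ioo y₀ (y₀ + s)) hd' fun t ht =>
        ⟨hz.1, Ioo_subset_Icc_self ht⟩).hasDerivAt (Ioo_mem_nhds hy.1 hy.2)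
      have h3 : (fun t => a (x, t) * deriv (fun t' => u (x, t')) t) =ᶠ[𝓝 y]
          fun t => a (x, t) * dy R u (x, t) := by
        filter_upwards [Ioo_mem_nhds hy.1 hy.2] with t ht
        rw [deriv_eq_dy (hu.of_le (by norm_cast)) hx ht]
      rw [h3.deriv_eq]
      exact (h1.mul h2).deriv
    rw [e1, e2] at hp
    dsimp only
    linarith
  · have c1 := ha.continuousOn
    have c2 := (contDiffOn_dx hr hs hux).continuousOn
    have c3 := (contDiffOn_dy hr hs huy).continuousOn
    exact ((c1.mul c2).add (c1.mul c3)).add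
      (((contDiffOn_dx hr hs ha).continuousOn.mul hux.continuousOn).add
        ((contDiffOn_dy hr hs ha).continuousOn.mul huy.continuousOn))

/-- Since the equation holds up to the boundary, its (m, n)-jet can be taken at the corner and
expanded by the Leibniz rule. Only orders m + n ≤ 4 occur, within the C^5 regularity of u_xx, u_yy
and the gradient of `a`. -/
lemma Solution.jetEq (hr : 0 < r) (hs : 0 < s)
    (ha : ContDiffOn ℝ ((6 : ℕ) : WithTop ℕ∞) a (rect x₀ y₀ r s))
    (hu : ContDiffOn ℝ ((7 : ℕ) : WithTop ℕ∞) u (rect x₀ y₀ r s))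
    (h : Solution 5 x₀ y₀ r s a α u f g₁ g₃) (m n : ℕ) (hmn : m + n + 2 ≤ 6) :
    JetEq (jet₂ a x₀ y₀) (jet₂ f x₀ y₀) (jet₂ u x₀ y₀) m n := by
  have H := jet₂_congr hr hs (h.pde_on_rect hr hs ha hu) m n
  set R := rect x₀ y₀ r s
  have hux := contDiffOn_dx hr hs hu
  have huy := contDiffOn_dy hr hs hu
  have huxx := contDiffOn_dx hr hs hux
  have huyy := contDiffOn_dy hr hs huy
  have hax := contDiffOn_dx hr hs ha
  have hay := contDiffOn_dy hr hs ha
  have L : ∀ {v : ℝ × ℝ → ℝ} {k : ℕ}, 5 ≤ k → ContDiffOn ℝ (k : WithTop ℕ∞) v R → ∀ l : ℕ, l ≤ 5 →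
      ContDiffOn ℝ (l : WithTop ℕ∞) v R := fun hk hv l hl =>
    hv.of_le (by norm_cast; omega)
  have C : ∀ {v w : ℝ × ℝ → ℝ}, ContDiffOn ℝ ((m + n : ℕ) : WithTop ℕ∞) v R →
      ContDiffOn ℝ ((m + n : ℕ) : WithTop ℕ∞) w R →
      ContDiffOn ℝ ((m + n : ℕ) : WithTop ℕ∞) (fun z => v z * w z) R := fun h h' => h.mul h'
  have ha' := L (by norm_num) ha (m + n) (by omega)
  have hux' := L (by norm_num) hux (m + n) (by omega)
  have huy' := L (by norm_num) huy (m + n) (by omega)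
  have huxx' := L le_rfl huxx (m + n) (by omega)
  have huyy' := L le_rfl huyy (m + n) (by omega)
  have hax' := L le_rfl hax (m + n) (by omega)
  have hay' := L le_rfl hay (m + n) (by omega)
  rw [jet₂_neg, jet₂_add hr hs m n ((C ha' huxx').add (C ha' huyy'))
    ((C hax' hux').add (C hay' huy')), jet₂_add hr hs m n (C ha' huxx') (C ha' huyy'),
    jet₂_add hr hs m n (C hax' hux') (C hay' huy'), jet₂_mul hr hs m n ha' huxx',
    jet₂_mul hr hs m n ha' huyy', jet₂_mul hr hs m n hax' hux', jet₂_mul hr hs m n hay' huy'] at H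
  unfold JetEq
  rw [← H]
  simp only [← Finset.sum_add_distrib]
  refine Finset.sum_congr rfl fun i hi => Finset.sum_congr rfl fun j hj => ?_
  have hi := Finset.mem_range.1 hi
  have hj := Finset.mem_range.1 hj
  rw [jet₂_dx hr hs i j (ha.of_le (by norm_cast; omega)),
    jet₂_dy hr hs i j (ha.of_le (by norm_cast; omega)),
    jet₂_dx hr hs _ _ (hu.of_le (by norm_cast; omega)),
    jet₂_dy hr hs _ _ (hu.of_le (by norm_cast; omega)),
    jet₂_dx hr hs _ _ (hux.of_le (by norm_cast; omega)),
    jet₂_dy hr hs _ _ (huy.of_le (by norm_cast; omega)),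
    jet₂_dx hr hs _ _ (hu.of_le (by norm_cast; omega)),
    jet₂_dy hr hs _ _ (hu.of_le (by norm_cast; omega))]
  unfold jetTerm
  ring

/-- The boundary condition extends by continuity to the closed side, hence to the corner, and is
differentiated along the side; the mixed derivatives commute. -/
lemma Solution.robinJet_eq (hr : 0 < r) (hs : 0 < s)
    (hα : ContDiffOn ℝ ((5 : ℕ) : WithTop ℕ∞) α (Icc y₀ (y₀ + s)))
    (hu : ContDiffOn ℝ ((7 : ℕ) : WithTop ℕ∞) u (rect x₀ y₀ r s))
    (h : Solution 5 x₀ y₀ r s a α u f g₁ g₃) (n : ℕ) (hn : n + 1 ≤ 6) :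
    robinJet (jet₁ α y₀) (jet₂ u x₀ y₀ 0) (jet₁ g₁ y₀) n = jet₂ u x₀ y₀ 1 n := by
  have hy : y₀ ∈ Icc y₀ (y₀ + s) := ⟨le_rfl, by linarith⟩
  have hx : x₀ ∈ Icc x₀ (x₀ + r) := ⟨le_rfl, by linarith⟩
  have hUy : UniqueDiffOn ℝ (Icc y₀ (y₀ + s)) := uniqueDiffOn_Icc (by linarith)
  set R := rect x₀ y₀ r s
  have hux := contDiffOn_dx hr hs hu
  have hu0 := contDiffOn_slice_y hx (hu.of_le (m := (5 : ℕ)) (by norm_cast))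
  have hux0 := contDiffOn_slice_y hx (hux.of_le (m := (5 : ℕ)) (by norm_cast))
  have H : EqOn g₁ (fun y => -dx R u (x₀, y) + ((fun y => u (x₀, y)) * α) y)
      (Icc y₀ (y₀ + s)) := by
    refine EqOn.of_subset_closure (s := Ioo y₀ (y₀ + s)) ?_ h.contDiffOn_g₁.continuousOn
      (hux0.continuousOn.neg.add (hu0.continuousOn.mul hα.continuousOn)) Ioo_subset_Icc_self
      (closure_Ioo (by linarith)).ge
    intro y hy
    rw [← h.robin y hy]
    have hd : DifferentiableWithinAt ℝ u R (x₀, y) :=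
      hu.differentiableOn (by norm_num) _ ⟨hx, Ioo_subset_Icc_self hy⟩
    rw [← derivWithin_congr_set (Icc_eventuallyEq_Ici hr),
      (hasDerivWithinAt_dx (S := Icc x₀ (x₀ + r)) hd fun t ht =>
        ⟨ht, Ioo_subset_Icc_self hy⟩).derivWithin (uniqueDiffOn_Icc (by linarith) x₀ hx)]
    simp [mul_comm]
  have L : ∀ {v : ℝ → ℝ}, ContDiffOn ℝ ((5 : ℕ) : WithTop ℕ∞) v (Icc y₀ (y₀ + s)) →
      ContDiffWithinAt ℝ (n : WithTop ℕ∞) v (Icc y₀ (y₀ + s)) y₀ := fun hv =>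
    (hv.of_le (by norm_cast; omega)) y₀ hy
  have H' : jet₁ g₁ y₀ n = -jet₂ u x₀ y₀ 1 n + ∑ i ∈ Finset.range (n + 1),
      (n.choose i : ℝ) * jet₂ u x₀ y₀ 0 i * jet₁ α y₀ (n - i) := by
    unfold jet₁
    rw [iteratedDerivWithin_Ici_eq hs, iteratedDerivWithin_congr H hy,
      iteratedDerivWithin_fun_add (g := (fun y => u (x₀, y)) * α) hy hUy (L hux0).neg
        ((L hu0).mul (L hα)),
      iteratedDerivWithin_fun_neg, iteratedDerivWithin_mul hy hUy (L hu0) (L hα),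
      iteratedDerivWithin_slice_y hr hs (hux.of_le (by norm_cast; omega)) hx hy,
      dy_iterate_dx_comm hr hs n (hu.of_le (by norm_cast; omega)) (corner_mem hr hs),
      jet₂_eq hr hs 1 n (hu.of_le (by norm_cast; omega))]
    congr 1
    refine Finset.sum_congr rfl fun i hi => ?_
    have hi := Finset.mem_range.1 hi
    rw [iteratedDerivWithin_slice_y hr hs (hu.of_le (by norm_cast; omega)) hx hy,
      jet₂_eq hr hs 0 i (hu.of_le (by norm_cast; omega)), iteratedDerivWithin_Ici_eq hs]
    rfl
  unfold robinJet
  rw [H']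
  have : ∑ i ∈ Finset.range (n + 1), (n.choose i : ℝ) * jet₁ α y₀ (n - i) * jet₂ u x₀ y₀ 0 i
      = ∑ i ∈ Finset.range (n + 1), (n.choose i : ℝ) * jet₂ u x₀ y₀ 0 i * jet₁ α y₀ (n - i) :=
    Finset.sum_congr rfl fun i _ => by ring
  rw [this]
  ring

lemma Solution.neumannJet_eq (hr : 0 < r) (hs : 0 < s)
    (hu : ContDiffOn ℝ ((7 : ℕ) : WithTop ℕ∞) u (rect x₀ y₀ r s))
    (h : Solution 5 x₀ y₀ r s a α u f g₁ g₃) (m : ℕ) (hm : m + 1 ≤ 6) :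
    -jet₁ g₃ x₀ m = jet₂ u x₀ y₀ m 1 := by
  have hy : y₀ ∈ Icc y₀ (y₀ + s) := ⟨le_rfl, by linarith⟩
  have hx : x₀ ∈ Icc x₀ (x₀ + r) := ⟨le_rfl, by linarith⟩
  set R := rect x₀ y₀ r s
  have huy := contDiffOn_dy hr hs hu
  have huy0 := contDiffOn_slice_x hy (huy.of_le (m := (5 : ℕ)) (by norm_cast))
  have H : EqOn g₃ (fun x => -dy R u (x, y₀)) (Icc x₀ (x₀ + r)) := by
    refine EqOn.of_subset_closure (s := Ioo x₀ (x₀ + r)) ?_ h.contDiffOn_g₃.continuousOn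
      huy0.continuousOn.neg Ioo_subset_Icc_self (closure_Ioo (by linarith)).ge
    intro x hx
    rw [← h.neumann x hx]
    have hd : DifferentiableWithinAt ℝ u R (x, y₀) :=
      hu.differentiableOn (by norm_num) _ ⟨Ioo_subset_Icc_self hx, hy⟩
    rw [← derivWithin_congr_set (Icc_eventuallyEq_Ici hs),
      (hasDerivWithinAt_dy (S := Icc y₀ (y₀ + s)) hd fun t ht =>
        ⟨Ioo_subset_Icc_self hx, ht⟩).derivWithin (uniqueDiffOn_Icc (by linarith) y₀ hy)]
  unfold jet₁
  rw [iteratedDerivWithin_Ici_eq hr, iteratedDerivWithin_congr H hx, iteratedDerivWithin_fun_neg,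
    neg_neg, iteratedDerivWithin_slice_x hr hs (huy.of_le (by norm_cast; omega)) hx hy,
    jet₂_eq hr hs m 1 (hu.of_le (by norm_cast; omega))]
  rfl

end Solution

/-! ### Taylor's formula on the rectangle -/

lemma sum_Lam (M : ℕ) (g : ℕ × ℕ → ℝ) :
    ∑ p ∈ Lam M, g p = ∑ n ∈ Finset.range (M + 1), ∑ m ∈ Finset.range (M + 1 - n), g (m, n) := by
  rw [Lam, Finset.sum_filter, Finset.sum_product_right]
  refine Finset.sum_congr rfl fun n hn => ?_
  rw [← Finset.sum_filter]
  refine Finset.sum_congr ?_ fun _ _ => rfl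
  ext m
  simp only [Finset.mem_filter, Finset.mem_range]
  omega

/-- Taylor's formula in y at fixed x, with a uniform bound from compactness, followed by Taylor's
formula in x, to degree d - n, for each coefficient ∂ʸⁿu(·, y₀). The two remainders are O(h^(d+1))
each. -/
lemma taylor_remainder_bound {x₀ y₀ r s : ℝ} {u : ℝ × ℝ → ℝ} (hr : 0 < r) (hs : 0 < s) (d : ℕ)
    (hu : ContDiffOn ℝ ((d + 1 : ℕ) : WithTop ℕ∞) u (rect x₀ y₀ r s)) :
    ∃ K, ∀ h, 0 ≤ h → h ≤ r → h ≤ s → ∀ x ∈ Icc 0 h, ∀ y ∈ Icc 0 h,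
      |u (x₀ + x, y₀ + y) - taylorPoly d (jet₂ u x₀ y₀) x y| ≤ K * h ^ (d + 1) := by
  have hy0 : y₀ ∈ Icc y₀ (y₀ + s) := ⟨le_rfl, by linarith⟩
  have hx0 : x₀ ∈ Icc x₀ (x₀ + r) := ⟨le_rfl, by linarith⟩
  set R := rect x₀ y₀ r s
  have hRc : IsCompact R := isCompact_Icc.prod isCompact_Icc
  obtain ⟨C, hC⟩ := hRc.exists_bound_of_continuousOn
    (contDiffOn_dy_iterate hr hs (n := 0) (d + 1) (by simpa using hu)).continuousOn
  have hslice : ∀ n ≤ d, ∃ B, ∀ x ∈ Icc x₀ (x₀ + r), ‖(dy R)^[n] u (x, y₀) -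
      taylorWithinEval (fun t => (dy R)^[n] u (t, y₀)) (d - n) (Icc x₀ (x₀ + r)) x₀ x‖
        ≤ B * (x - x₀) ^ (d - n + 1) := by
    intro n hn
    refine exists_taylor_mean_remainder_bound (by linarith) ?_
    have h1 := contDiffOn_dy_iterate hr hs (n := d - n + 1) n
      (by rwa [show d - n + 1 + n = d + 1 by omega])
    have h2 := contDiffOn_slice_x hy0 h1
    exact_mod_cast h2
  choose! B hB using hslice
  refine ⟨|C| + ∑ n ∈ Finset.range (d + 1), |B n|, fun h h0 hhr hhs x hx y hy => ?_⟩
  have hxm : x₀ + x ∈ Icc x₀ (x₀ + r) := ⟨by linarith [hx.1], by linarith [hx.2]⟩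
  have hym : y₀ + y ∈ Icc y₀ (y₀ + s) := ⟨by linarith [hy.1], by linarith [hy.2]⟩
  have e1 := taylor_mean_remainder_bound (n := d) (C := C) (by linarith : y₀ ≤ y₀ + s)
    (by exact_mod_cast contDiffOn_slice_y hxm hu) hym (fun t ht => by
      rw [iteratedDerivWithin_slice_y hr hs hu hxm ht]
      exact hC _ ⟨hxm, ht⟩)
  rw [taylor_within_apply] at e1
  simp only [add_sub_cancel_left, smul_eq_mul] at e1
  have e2 : |u (x₀ + x, y₀ + y) - ∑ n ∈ Finset.range (d + 1), ((n.factorial : ℝ)⁻¹ * y ^ n) *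
      (dy R)^[n] u (x₀ + x, y₀)| ≤ |C| * h ^ (d + 1) := by
    have : ∑ n ∈ Finset.range (d + 1), ((n.factorial : ℝ)⁻¹ * y ^ n) *
        (dy R)^[n] u (x₀ + x, y₀) = ∑ n ∈ Finset.range (d + 1), ((n.factorial : ℝ)⁻¹ * y ^ n) *
        iteratedDerivWithin n (fun t => u (x₀ + x, t)) (Icc y₀ (y₀ + s)) y₀ :=
      Finset.sum_congr rfl fun n hn => by
        have hn := Finset.mem_range.1 hn
        rw [iteratedDerivWithin_slice_y hr hs (hu.of_le (by norm_cast; omega)) hxm hy0]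
    rw [this, ← Real.norm_eq_abs]
    refine e1.trans ?_
    have h1 : (1 : ℝ) ≤ d.factorial := by exact_mod_cast Nat.factorial_pos d
    have h2 : C * y ^ (d + 1) ≤ |C| * h ^ (d + 1) :=
      mul_le_mul (le_abs_self C) (pow_le_pow_left₀ hy.1 hy.2 _) (pow_nonneg hy.1 _) (abs_nonneg C)
    exact (div_le_div_of_nonneg_right h2 (by linarith)).trans (div_le_self (by positivity) h1)
  have e3 : ∀ n ∈ Finset.range (d + 1), |((n.factorial : ℝ)⁻¹ * y ^ n) *
      (dy R)^[n] u (x₀ + x, y₀) - ∑ m ∈ Finset.range (d + 1 - n), jet₂ u x₀ y₀ m n * x ^ m * y ^ n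
        / ((m.factorial : ℝ) * (n.factorial : ℝ))| ≤ |B n| * h ^ (d + 1) := by
    intro n hn
    have hn := Finset.mem_range.1 hn
    have e4 := hB n (by omega) _ hxm
    rw [taylor_within_apply] at e4
    simp only [add_sub_cancel_left, smul_eq_mul] at e4
    have e5 : ∑ m ∈ Finset.range (d + 1 - n), jet₂ u x₀ y₀ m n * x ^ m * y ^ n
        / ((m.factorial : ℝ) * (n.factorial : ℝ)) = ((n.factorial : ℝ)⁻¹ * y ^ n) *
        ∑ m ∈ Finset.range (d - n + 1), ((m.factorial : ℝ)⁻¹ * x ^ m) *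
          iteratedDerivWithin m (fun t => (dy R)^[n] u (t, y₀)) (Icc x₀ (x₀ + r)) x₀ := by
      rw [Finset.mul_sum, show d + 1 - n = d - n + 1 by omega]
      refine Finset.sum_congr rfl fun m hm => ?_
      have hm := Finset.mem_range.1 hm
      have h1 := contDiffOn_dy_iterate hr hs (n := m) n (hu.of_le (by norm_cast; omega))
      rw [iteratedDerivWithin_slice_x hr hs h1 hx0 hy0,
        jet₂_eq hr hs m n (hu.of_le (by norm_cast; omega))]
      field_simp
    rw [e5, ← mul_sub, abs_mul, ← Real.norm_eq_abs (_ - _)]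
    have e6 : |(n.factorial : ℝ)⁻¹ * y ^ n| ≤ h ^ n := by
      rw [abs_of_nonneg (mul_nonneg (by positivity) (pow_nonneg hy.1 n))]
      have h1 : (n.factorial : ℝ)⁻¹ ≤ 1 := inv_le_one_of_one_le₀
        (by exact_mod_cast Nat.one_le_iff_ne_zero.2 (Nat.factorial_ne_zero n))
      calc (n.factorial : ℝ)⁻¹ * y ^ n ≤ 1 * h ^ n :=
            mul_le_mul h1 (pow_le_pow_left₀ hy.1 hy.2 n) (pow_nonneg hy.1 n) zero_le_one
        _ = h ^ n := one_mul _
    calc _ ≤ h ^ n * (|B n| * h ^ (d - n + 1)) := by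
          refine mul_le_mul e6 (e4.trans ?_) (norm_nonneg _) (pow_nonneg h0 n)
          exact mul_le_mul (le_abs_self _) (pow_le_pow_left₀ hx.1 hx.2 _) (pow_nonneg hx.1 _)
            (abs_nonneg _)
      _ = |B n| * (h ^ n * h ^ (d - n + 1)) := by ring
      _ = |B n| * h ^ (d + 1) := by rw [← pow_add]; congr 2; omega
  have e7 : taylorPoly d (jet₂ u x₀ y₀) x y = ∑ n ∈ Finset.range (d + 1),
      ∑ m ∈ Finset.range (d + 1 - n), jet₂ u x₀ y₀ m n * x ^ m * y ^ n
        / ((m.factorial : ℝ) * (n.factorial : ℝ)) := by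
    unfold taylorPoly
    rw [sum_Lam]
  rw [e7, add_mul, Finset.sum_mul]
  refine (abs_sub_le _ (∑ n ∈ Finset.range (d + 1), ((n.factorial : ℝ)⁻¹ * y ^ n) *
      (dy R)^[n] u (x₀ + x, y₀)) _).trans (add_le_add e2 ?_)
  rw [← Finset.sum_sub_distrib]
  exact (Finset.abs_sum_le_sum_abs _ _).trans (Finset.sum_le_sum e3)

/-! ### Consistency of the corner scheme -/

lemma stencilSum_add (c : Fin 2 → Fin 2 → Fin 7 → ℝ) (E E' : ℝ → ℝ → ℝ) (h : ℝ) :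
    stencilSum c (fun x y => E x y + E' x y) h = stencilSum c E h + stencilSum c E' h := by
  simp only [stencilSum, mul_add, Finset.sum_add_distrib]

lemma stencilSum_sum {ι : Type*} (c : Fin 2 → Fin 2 → Fin 7 → ℝ) (S : Finset ι) (b : ι → ℝ)
    (E : ι → ℝ → ℝ → ℝ) (h : ℝ) :
    stencilSum c (fun x y => ∑ i ∈ S, b i * E i x y) h = ∑ i ∈ S, b i * stencilSum c (E i) h := by
  simp only [stencilSum, Fin.sum_univ_two, Finset.mul_sum, ← Finset.sum_add_distrib]
  exact Finset.sum_congr rfl fun i _ => by ring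

lemma continuous_polyC (c : Fin 2 → Fin 2 → Fin 7 → ℝ) (k ℓ : Fin 2) :
    Continuous (polyC c k ℓ) := by
  unfold polyC
  fun_prop

lemma polyC_zero (c : Fin 2 → Fin 2 → Fin 7 → ℝ) (k ℓ : Fin 2) : polyC c k ℓ 0 = c k ℓ 0 := by
  simp [polyC, Fin.sum_univ_succ]

lemma natCast_fin_two_mul_mem_Icc (k : Fin 2) {h : ℝ} (h0 : 0 ≤ h) :
    ((k : ℕ) : ℝ) * h ∈ Icc 0 h := by
  fin_cases k <;> simp [h0]

/-- The stencil applied to the Taylor polynomial gives exactly the right-hand side plus the four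
sums of the linear system. The residual therefore consists of Taylor remainders and of terms that
the system makes O(h^7). -/
theorem cornerScheme_consistent {x₀ y₀ r s : ℝ} (hr : 0 < r) (hs : 0 < s) {l : Filter ℝ}
    (hl : l ≤ 𝓝[>] 0) {a : ℝ × ℝ → ℝ} {α : ℝ → ℝ} (hc : Coefficients 5 x₀ y₀ r s a α)
    {c : Fin 2 → Fin 2 → Fin 7 → ℝ} (hsys : SolvesSystem (jet₂ a x₀ y₀) (jet₁ α y₀) c) :
    (cornerScheme (jet₂ a x₀ y₀) (jet₁ α y₀) c).Consistent 5 l x₀ y₀ r s a α 6 := by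
  intro u f g₁ g₃ hsol
  have hl0 : l ≤ 𝓝 0 := hl.trans nhdsWithin_le_nhds
  have ha : ContDiffOn ℝ ((6 : ℕ) : WithTop ℕ∞) a (rect x₀ y₀ r s) := hc.contDiffOn_a
  have hα : ContDiffOn ℝ ((5 : ℕ) : WithTop ℕ∞) α (Icc y₀ (y₀ + s)) := hc.contDiffOn_α
  have hu : ContDiffOn ℝ ((7 : ℕ) : WithTop ℕ∞) u (rect x₀ y₀ r s) := hsol.contDiffOn_u
  have hA : jet₂ a x₀ y₀ 0 0 ≠ 0 := by
    simpa [jet₂] using (hc.a_pos _ (corner_mem hr hs)).ne'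
  have hT := taylorPoly_eq_corner hA (hsol.jetEq hr hs ha hu) (hsol.robinJet_eq hr hs hα hu)
    (hsol.neumannJet_eq hr hs hu)
  obtain ⟨K, hK⟩ := taylor_remainder_bound hr hs 6 hu
  set A := jet₂ a x₀ y₀
  set al := jet₁ α y₀
  set J := jet₂ u x₀ y₀
  have key : ∀ h, (cornerScheme A al c).lhs x₀ y₀ u h - (cornerScheme A al c).rhs x₀ y₀ f g₁ g₃ h
      = ∑ k : Fin 2, ∑ ℓ : Fin 2, polyC c k ℓ h * (u (x₀ + (k : ℕ) * h, y₀ + (ℓ : ℕ) * h)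
          - taylorPoly 6 J ((k : ℕ) * h) ((ℓ : ℕ) * h))
        + ∑ n ∈ ({0, 2, 4, 6} : Finset ℕ), J 0 n * stencilSum c (cornerE A al n) h := by
    intro h
    have e1 : stencilSum c (taylorPoly 6 J) h = ∑ n ∈ ({0, 2, 4, 6} : Finset ℕ),
        J 0 n * stencilSum c (cornerE A al n) h
        + (∑ p ∈ Lam 4, jet₂ f x₀ y₀ p.1 p.2 * stencilSum c (cornerF A al p.1 p.2) h
        + ∑ n ∈ Finset.range 6, jet₁ g₁ y₀ n * stencilSum c (cornerG₁ A al n) h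
        + ∑ n ∈ Finset.range 6, jet₁ g₃ x₀ n * stencilSum c (cornerG₃ A al n) h) := by
      rw [show taylorPoly 6 J = _ from funext fun x => funext fun y => hT x y, stencilSum_add,
        stencilSum_add, stencilSum_add, stencilSum_sum, stencilSum_sum, stencilSum_sum,
        stencilSum_sum]
    have e2 : ∑ k : Fin 2, ∑ ℓ : Fin 2, polyC c k ℓ h *
        (u (x₀ + (k : ℕ) * h, y₀ + (ℓ : ℕ) * h) - taylorPoly 6 J ((k : ℕ) * h) ((ℓ : ℕ) * h))
        = (cornerScheme A al c).lhs x₀ y₀ u h - stencilSum c (taylorPoly 6 J) h := by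
      simp only [mul_sub, Finset.sum_sub_distrib]
      rfl
    rw [e2, e1]
    simp only [FourPointScheme.rhs, cornerScheme]
    ring
  simp_rw [key]
  refine IsBigO.add (IsBigO.fun_sum fun k _ => IsBigO.fun_sum fun ℓ _ => ?_) (IsBigO.fun_sum fun n hn => ?_)
  · have h1 : (polyC c k ℓ) =O[l] (fun _ => (1 : ℝ)) :=
      (((continuous_polyC c k ℓ).tendsto 0).mono_left hl0).isBigO_one ℝ
    have h2 : (fun h => u (x₀ + (k : ℕ) * h, y₀ + (ℓ : ℕ) * h)
        - taylorPoly 6 J ((k : ℕ) * h) ((ℓ : ℕ) * h)) =O[l] fun h => h ^ (6 + 1) := by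
      refine IsBigO.of_bound K ?_
      have h3 : ∀ᶠ h in l, 0 < h := hl self_mem_nhdsWithin
      filter_upwards [h3, hl0 (Iio_mem_nhds hr), hl0 (Iio_mem_nhds hs)] with h h0 hhr hhs
      rw [Real.norm_eq_abs, Real.norm_eq_abs, abs_of_nonneg (pow_nonneg h0.le _)]
      exact hK h h0.le (le_of_lt hhr) (le_of_lt hhs) _ (natCast_fin_two_mul_mem_Icc k h0.le) _
        (natCast_fin_two_mul_mem_Icc ℓ h0.le)
    simpa using h1.mul h2
  · exact ((hsys n (by simpa using hn)).mono hl0).const_mul_left _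

theorem cornerScheme_nondegenerate {l : Filter ℝ} (hl : l ≤ 𝓝[>] 0) (A : ℕ → ℕ → ℝ) (al : ℕ → ℝ)
    {c : Fin 2 → Fin 2 → Fin 7 → ℝ} (hc : ∃ k ℓ, c k ℓ 0 ≠ 0) :
    (cornerScheme A al c).Nondegenerate l := by
  obtain ⟨k, ℓ, hkl⟩ := hc
  refine ⟨|c k ℓ 0| / 2, by positivity, ?_⟩
  have h1 : Tendsto (fun h => |polyC c k ℓ h|) l (𝓝 |c k ℓ 0|) := by
    rw [← polyC_zero c k ℓ]
    exact (((continuous_polyC c k ℓ).abs).tendsto 0).mono_left (hl.trans nhdsWithin_le_nhds)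
  filter_upwards [h1.eventually (eventually_gt_nhds (half_lt_self (abs_pos.2 hkl)))] with h hh
  exact ⟨k, ℓ, hh.le⟩

/-! ### Solvability of the linear system -/

open Polynomial in
lemma isBigO_eval {p : ℝ[X]} {n : ℕ} (hp : X ^ n ∣ p) :
    (fun h => p.eval h) =O[𝓝 0] fun h => h ^ n := by
  obtain ⟨q, rfl⟩ := hp
  simp only [eval_mul, eval_pow, eval_X]
  simpa using (isBigO_refl (fun h : ℝ => h ^ n) (𝓝 0)).mul
    ((q.continuous.tendsto 0).isBigO_one ℝ)

/-- The values of the Taylor polynomial of degree `6` at `(kh, ℓh)`, as a polynomial in `h`. -/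
noncomputable def gridPoly (J : ℕ → ℕ → ℝ) (k ℓ : ℕ) : Polynomial ℝ :=
  ∑ p ∈ Lam 6, Polynomial.monomial (p.1 + p.2) (J p.1 p.2 * (k : ℝ) ^ p.1 * (ℓ : ℝ) ^ p.2 /
    ((p.1.factorial : ℝ) * (p.2.factorial : ℝ)))

lemma eval_gridPoly (J : ℕ → ℕ → ℝ) (k ℓ : ℕ) (h : ℝ) :
    (gridPoly J k ℓ).eval h = taylorPoly 6 J (k * h) (ℓ * h) := by
  unfold gridPoly taylorPoly
  rw [Polynomial.eval_finsetSum]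
  refine Finset.sum_congr rfl fun p _ => ?_
  rw [Polynomial.eval_monomial, mul_pow, mul_pow, pow_add]
  ring

lemma coeff_gridPoly (J : ℕ → ℕ → ℝ) (k ℓ n : ℕ) :
    (gridPoly J k ℓ).coeff n = ∑ p ∈ Lam 6, if p.1 + p.2 = n then J p.1 p.2 * (k : ℝ) ^ p.1 *
      (ℓ : ℝ) ^ p.2 / ((p.1.factorial : ℝ) * (p.2.factorial : ℝ)) else 0 := by
  unfold gridPoly
  simp only [Polynomial.finsetSum_coeff, Polynomial.coeff_monomial]

/-- The jet of `Re (y + ix)ⁿ / n!`. -/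
def harmonicJet (n m j : ℕ) : ℝ := if m + j = n ∧ Even m then (-1) ^ (m / 2) else 0

lemma harmonicJet_add (n m j : ℕ) : harmonicJet n (m + 2) j + harmonicJet n m (j + 2) = 0 := by
  unfold harmonicJet
  by_cases hm : Even m
  · have h1 : Even (m + 2) := by simpa [Nat.even_add] using hm
    have h2 : (m + 2) / 2 = m / 2 + 1 := by omega
    by_cases hn : m + j + 2 = n
    · rw [if_pos ⟨by omega, h1⟩, if_pos ⟨by omega, hm⟩, h2, pow_succ]
      ring
    · rw [if_neg (fun h => hn (by omega)), if_neg (fun h => hn (by omega)), add_zero]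
  · have h1 : ¬Even (m + 2) := by simpa [Nat.even_add] using hm
    simp [hm, h1]

lemma harmonicJet_of_ne {n m j : ℕ} (h : m + j ≠ n) : harmonicJet n m j = 0 :=
  if_neg fun h' => h h'.1

/-- The homogeneous polynomial of degree n has no derivatives of order below n at the origin. In the
stated range the first-order terms thus vanish and the second-order terms cancel by harmonicity, for
variable coefficients as well. -/
lemma jetEq_harmonicJet (A : ℕ → ℕ → ℝ) (n m j : ℕ) (h : m + j + 2 ≤ n) :
    JetEq A (fun _ _ => 0) (harmonicJet n) m j := by
  unfold JetEq
  rw [neg_zero]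
  refine Finset.sum_eq_zero fun i _ => Finset.sum_eq_zero fun i' _ => ?_
  unfold jetTerm
  rw [harmonicJet_add, harmonicJet_of_ne (by omega), harmonicJet_of_ne (by omega)]
  ring

/-- To leading order, `cornerE` is `Re (y + ix)ⁿ / n!`. -/
lemma cornerE_eq {A : ℕ → ℕ → ℝ} (hA : A 0 0 ≠ 0) (al : ℕ → ℝ) {n : ℕ} (hn : Even n) :
    ∃ J : ℕ → ℕ → ℝ, (∀ x y, cornerE A al n x y = taylorPoly 6 J x y) ∧
      ∀ m j, m + j ≤ n → J m j = harmonicJet n m j := by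
  -- The left side involves only traces of order below n, which vanish; the right side vanishes
  -- because Re (y + ix)ⁿ is even in x. The Neumann condition holds because it is also even in y for
  -- even n.
  have hR : ∀ j, j + 1 ≤ n → robinJet al (harmonicJet n 0) (fun _ => 0) j = harmonicJet n 1 j := by
    intro j hj
    have h1 : harmonicJet n 1 j = 0 := if_neg fun h => by simp at h
    rw [h1, robinJet, sub_zero]
    refine Finset.sum_eq_zero fun i hi => ?_
    have hi := Finset.mem_range.1 hi
    rw [harmonicJet_of_ne (by omega), mul_zero]
  have ht := traceJet_eq (A := A) (F := fun _ _ => 0) (J := harmonicJet n) (al := al)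
    (e := fun j => if j = n then 1 else 0) (G₁ := fun _ => 0) (G₃ := fun _ => 0) (N := n) hA
    (fun m j h => jetEq_harmonicJet A n m j h) hR
    (by
      intro m hm
      have : harmonicJet n m 1 = 0 := if_neg fun h => by
        rw [← h.1] at hn
        exact absurd hn (by simp [Nat.even_add, h.2])
      rw [this, neg_zero])
    (by
      intro j hj _
      by_cases h : j = n <;> simp [harmonicJet, h])
  refine ⟨_, fun x y => cornerExpansion_eq_taylorPoly hA al _ _ _ _ x y, fun m j hmj => ?_⟩
  refine vJet_eq_of_jetEq (N := n) hA (fun i j h => jetEq_harmonicJet A n i j h) (fun _ _ _ => rfl)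
    (fun j hj => ht j hj.le) (fun j hj => ?_) m j hmj (Or.inl (ht n le_rfl))
  rw [← hR j hj]
  exact robinJet_congr (fun i hi => ht i (by omega)) rfl

open Polynomial in
/-- The values of `cornerE` at the four grid points are `hⁿ` times polynomials in `h`. -/
lemma exists_cornerE_eval {A : ℕ → ℕ → ℝ} (hA : A 0 0 ≠ 0) (al : ℕ → ℝ) {n : ℕ} (hn : Even n) :
    ∃ Q : ℕ → ℕ → ℝ[X],
      (∀ (k ℓ : ℕ) (h : ℝ), cornerE A al n (k * h) (ℓ * h) = (X ^ n * Q k ℓ).eval h) ∧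
      (∀ k ℓ, (Q k ℓ).coeff 0 = (gridPoly (harmonicJet n) k ℓ).coeff n) ∧
      Q 0 0 = if n = 0 then 1 else 0 := by
  obtain ⟨J, hJ, hJ'⟩ := cornerE_eq hA al hn
  have hc : ∀ k ℓ, ∀ i ≤ n, (gridPoly J k ℓ).coeff i = (gridPoly (harmonicJet n) k ℓ).coeff i := by
    intro k ℓ i hi
    rw [coeff_gridPoly, coeff_gridPoly]
    refine Finset.sum_congr rfl fun p _ => ?_
    split_ifs with h
    · rw [hJ' _ _ (by omega)]
    · rfl
  -- Below degree n the jet of E_n agrees with that of a homogeneous polynomial of degree n, so it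
  -- vanishes.
  have hd : ∀ k ℓ, X ^ n ∣ gridPoly J k ℓ := by
    intro k ℓ
    rw [X_pow_dvd_iff]
    intro i hi
    rw [hc k ℓ i hi.le, coeff_gridPoly]
    refine Finset.sum_eq_zero fun p _ => ?_
    split_ifs with h
    · rw [harmonicJet_of_ne (by omega)]
      simp
    · rfl
  choose Q hQ using hd
  refine ⟨Q, fun k ℓ h => by rw [hJ, ← eval_gridPoly, hQ], fun k ℓ => ?_, ?_⟩
  · rw [← hc k ℓ n le_rfl, hQ k ℓ]
    simpa using (coeff_X_pow_mul (Q k ℓ) n 0).symm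
  · have h00 : gridPoly J 0 0 = C (J 0 0) := by
      unfold gridPoly
      rw [Finset.sum_eq_single (0, 0)]
      · simp
      · rintro ⟨i, j⟩ _ hne
        have : ¬(i = 0 ∧ j = 0) := fun h => hne (by rw [h.1, h.2])
        rcases Nat.eq_zero_or_pos i with hi | hi
        · rcases Nat.eq_zero_or_pos j with hj | hj
          · exact absurd ⟨hi, hj⟩ this
          · simp [hj.ne']
        · simp [hi.ne']
      · intro h
        exact absurd (mem_Lam.2 (by simp)) h
    have h1 := hQ 0 0
    rw [h00, hJ' 0 0 (by omega)] at h1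
    split_ifs with h
    · subst h
      simpa [harmonicJet] using h1.symm
    · rw [harmonicJet_of_ne (by omega), C_0] at h1
      exact (mul_eq_zero.1 h1.symm).resolve_left (pow_ne_zero _ X_ne_zero)

lemma coeff_gridPoly_harmonicJet_two (k ℓ : ℕ) :
    (gridPoly (harmonicJet 2) k ℓ).coeff 2 = (ℓ : ℝ) ^ 2 / 2 - (k : ℝ) ^ 2 / 2 := by
  rw [coeff_gridPoly, sum_Lam]
  norm_num [Finset.sum_range_succ, harmonicJet, Nat.factorial, Nat.even_iff]
  ring

lemma coeff_gridPoly_harmonicJet_four (k ℓ : ℕ) :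
    (gridPoly (harmonicJet 4) k ℓ).coeff 4 =
      (ℓ : ℝ) ^ 4 / 24 - (k : ℝ) ^ 2 * (ℓ : ℝ) ^ 2 / 4 + (k : ℝ) ^ 4 / 24 := by
  rw [coeff_gridPoly, sum_Lam]
  norm_num [Finset.sum_range_succ, harmonicJet, Nat.factorial, Nat.even_iff]
  ring

lemma coeff_gridPoly_harmonicJet_six (k ℓ : ℕ) :
    (gridPoly (harmonicJet 6) k ℓ).coeff 6 = (ℓ : ℝ) ^ 6 / 720 - (k : ℝ) ^ 2 * (ℓ : ℝ) ^ 4 / 48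
      + (k : ℝ) ^ 4 * (ℓ : ℝ) ^ 2 / 48 - (k : ℝ) ^ 6 / 720 := by
  rw [coeff_gridPoly, sum_Lam]
  norm_num [Finset.sum_range_succ, harmonicJet, Nat.factorial, Nat.even_iff]
  ring

open Polynomial in
theorem exists_solvesSystem {A : ℕ → ℕ → ℝ} (hA : A 0 0 ≠ 0) (al : ℕ → ℝ) :
    ∃ c : Fin 2 → Fin 2 → Fin 7 → ℝ, c 1 1 0 = 1 ∧ SolvesSystem A al c := by
  obtain ⟨Q0, h0, -, hz0⟩ := exists_cornerE_eval hA al (n := 0) (by decide)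
  obtain ⟨Q2, h2, hc2, hz2⟩ := exists_cornerE_eval hA al (n := 2) (by decide)
  obtain ⟨Q4, h4, hc4, hz4⟩ := exists_cornerE_eval hA al (n := 4) (by decide)
  obtain ⟨Q6, h6, hc6, hz6⟩ := exists_cornerE_eval hA al (n := 6) (by decide)
  simp only [coeff_gridPoly_harmonicJet_two] at hc2
  simp only [coeff_gridPoly_harmonicJet_four] at hc4
  simp only [coeff_gridPoly_harmonicJet_six] at hc6
  norm_num at hz0 hz2 hz4 hz6
  -- The determinant of the conditions n = 2, 4 for C₀₁ and C₁₀. Its constant term is (1/2)(1/24) +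
  -- (1/2)(1/24) = 1/24, so it is invertible modulo X^7 with inverse `b`; `P01` and `P10` come from
  -- Cramer's rule with C₁₁ = 1.
  set D : ℝ[X] := Q2 0 1 * Q4 1 0 - Q2 1 0 * Q4 0 1 with hD
  have hD0 : D.coeff 0 ≠ 0 := by
    rw [hD, coeff_sub, mul_coeff_zero, mul_coeff_zero, hc2, hc2, hc4, hc4]
    norm_num
  have hcop : IsCoprime D (X ^ 7) := by
    refine IsCoprime.pow_right (IsCoprime.symm ?_)
    exact (irreducible_X.coprime_iff_not_dvd).2 fun h => hD0 (X_dvd_iff.1 h)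
  obtain ⟨b, d, hbd⟩ := hcop
  set P01 := b * (Q2 1 0 * Q4 1 1 - Q2 1 1 * Q4 1 0) with hP01
  set P10 := b * (Q2 1 1 * Q4 0 1 - Q2 0 1 * Q4 1 1) with hP10
  set P00 := -(P01 * Q0 0 1 + P10 * Q0 1 0 + Q0 1 1) with hP00
  have r2 : P01 * Q2 0 1 + P10 * Q2 1 0 + Q2 1 1 = X ^ 7 * (d * Q2 1 1) := by
    rw [hP01, hP10]
    linear_combination (-Q2 1 1) * hbd + Q2 1 1 * b * hD
  have r4 : P01 * Q4 0 1 + P10 * Q4 1 0 + Q4 1 1 = X ^ 7 * (d * Q4 1 1) := by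
    rw [hP01, hP10]
    linear_combination (-Q4 1 1) * hbd + Q4 1 1 * b * hD
  -- The constant terms of the `Q6` are those of the `Q2` divided by 360, so the condition n = 2 at
  -- h = 0 implies this one.
  have r6 : X ∣ P01 * Q6 0 1 + P10 * Q6 1 0 + Q6 1 1 := by
    have e := congrArg (fun p => coeff p 0) r2
    simp only [coeff_add, mul_coeff_zero, hc2] at e
    rw [X_dvd_iff]
    simp only [coeff_add, mul_coeff_zero, hc6]
    norm_num at e ⊢
    linarith
  set P : Fin 2 → Fin 2 → ℝ[X] := ![![P00, P01], ![P10, 1]] with hP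
  -- The stencil coefficients may have degree at most 6; truncating `P` changes it only by multiples
  -- of X^7.
  set T : Fin 2 → Fin 2 → ℝ[X] := fun k ℓ => ∑ i : Fin 7, monomial (i : ℕ) ((P k ℓ).coeff i)
  have hT : ∀ k ℓ, X ^ 7 ∣ T k ℓ - P k ℓ := by
    intro k ℓ
    rw [X_pow_dvd_iff]
    intro i hi
    rw [coeff_sub, finsetSum_coeff, sub_eq_zero]
    simp only [coeff_monomial]
    rw [Finset.sum_eq_single ⟨i, hi⟩]
    · simp
    · intro j _ hj
      exact if_neg fun h => hj (Fin.ext h)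
    · simp
  refine ⟨fun k ℓ i => (P k ℓ).coeff i, by simp [hP], ?_⟩
  have main : ∀ (n : ℕ) (Q : ℕ → ℕ → ℝ[X]),
      (∀ (k ℓ : ℕ) (h : ℝ), cornerE A al n (k * h) (ℓ * h) = (X ^ n * Q k ℓ).eval h) →
      X ^ 7 ∣ X ^ n * (P00 * Q 0 0 + P01 * Q 0 1 + P10 * Q 1 0 + Q 1 1) →
      stencilSum (fun k ℓ i => (P k ℓ).coeff i) (cornerE A al n) =O[𝓝 0] (fun h => h ^ 7) := by
    intro n Q hQ hdvd
    have e1 : stencilSum (fun k ℓ i => (P k ℓ).coeff i) (cornerE A al n) = fun h =>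
        (∑ k : Fin 2, ∑ ℓ : Fin 2, T k ℓ * (X ^ n * Q k ℓ)).eval h := by
      funext h
      simp only [stencilSum, eval_finsetSum, eval_mul (p := T _ _), hQ]
      refine Finset.sum_congr rfl fun k _ => Finset.sum_congr rfl fun ℓ _ => ?_
      congr 1
      simp [polyC, T, eval_finsetSum]
    rw [e1]
    refine isBigO_eval ?_
    have e2 : ∑ k : Fin 2, ∑ ℓ : Fin 2, T k ℓ * (X ^ n * Q k ℓ)
        = ∑ k : Fin 2, ∑ ℓ : Fin 2, (T k ℓ - P k ℓ) * (X ^ n * Q k ℓ)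
          + X ^ n * (P00 * Q 0 0 + P01 * Q 0 1 + P10 * Q 1 0 + Q 1 1) := by
      simp [Fin.sum_univ_two, hP]
      ring
    rw [e2]
    exact dvd_add (Finset.dvd_sum fun k _ => Finset.dvd_sum fun ℓ _ => (hT k ℓ).mul_right _) hdvd
  intro n hn
  simp only [mem_insert_iff, mem_singleton_iff] at hn
  rcases hn with rfl | rfl | rfl | rfl
  · refine main 0 Q0 h0 ?_
    rw [hz0, hP00]
    ring_nf
    exact dvd_zero _
  · refine main 2 Q2 h2 ?_
    rw [hz2, mul_zero, zero_add, r2]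
    exact (dvd_mul_right _ _).mul_left _
  · refine main 4 Q4 h4 ?_
    rw [hz4, mul_zero, zero_add, r4]
    exact (dvd_mul_right _ _).mul_left _
  · refine main 6 Q6 h6 ?_
    rw [hz6, mul_zero, zero_add, pow_succ]
    exact mul_dvd_mul_left _ r6

/-! ### The order barrier for constant coefficients -/

/-- Smooth harmonic functions which satisfy the homogeneous boundary conditions solve the
problem with constant coefficients and zero data. -/
lemma solution_of_harmonic (x₀ y₀ r s a₀ α₀ : ℝ) {E Ex Exx Ey Eyy : ℝ → ℝ → ℝ}
    (hE : ∀ n : WithTop ℕ∞, ContDiff ℝ n fun z : ℝ × ℝ => E z.1 z.2)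
    (hx : ∀ x y, HasDerivAt (fun t => E t y) (Ex x y) x)
    (hxx : ∀ x y, HasDerivAt (fun t => Ex t y) (Exx x y) x)
    (hy : ∀ x y, HasDerivAt (fun t => E x t) (Ey x y) y)
    (hyy : ∀ x y, HasDerivAt (fun t => Ey x t) (Eyy x y) y)
    (hΔ : ∀ x y, Exx x y + Eyy x y = 0) (hR : ∀ y, Ex 0 y = α₀ * E 0 y) (hN : ∀ x, Ey x 0 = 0) :
    Solution ⊤ x₀ y₀ r s (fun _ => a₀) (fun _ => α₀) (fun z => E (z.1 - x₀) (z.2 - y₀))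
      (fun _ => 0) (fun _ => 0) (fun _ => 0) where
  contDiffOn_u := ((hE _).comp ((contDiff_fst.sub contDiff_const).prodMk
    (contDiff_snd.sub contDiff_const))).contDiffOn
  contDiffOn_f := contDiffOn_const
  contDiffOn_g₁ := contDiffOn_const
  contDiffOn_g₃ := contDiffOn_const
  pde x _ y _ := by
    have e1 : ∀ t, deriv (fun t' => E (t' - x₀) (y - y₀)) t = Ex (t - x₀) (y - y₀) := fun t =>
      ((hx _ _).comp_sub_const t x₀).deriv
    have e2 : ∀ t, deriv (fun t' => E (x - x₀) (t' - y₀)) t = Ey (x - x₀) (t - y₀) := fun t =>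
      ((hy _ _).comp_sub_const t y₀).deriv
    simp only [e1, e2]
    rw [(((hxx (x - x₀) (y - y₀)).comp_sub_const x x₀).const_mul a₀).deriv,
      (((hyy (x - x₀) (y - y₀)).comp_sub_const y y₀).const_mul a₀).deriv, ← mul_add, hΔ, mul_zero,
      neg_zero]
  robin y _ := by
    have h := ((hx (x₀ - x₀) (y - y₀)).comp_sub_const x₀ x₀).hasDerivWithinAt (s := Ici x₀)
    have h' := h.derivWithin (uniqueDiffOn_Ici x₀ x₀ self_mem_Ici)
    dsimp only
    rw [h', sub_self, hR, neg_add_cancel]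
  neumann x _ := by
    have h := ((hy (x - x₀) (y₀ - y₀)).comp_sub_const y₀ y₀).hasDerivWithinAt (s := Ici y₀)
    have h' := h.derivWithin (uniqueDiffOn_Ici y₀ y₀ self_mem_Ici)
    dsimp only
    rw [h', sub_self, hN, neg_zero]

lemma jet₁_zero (t₀ : ℝ) (n : ℕ) : jet₁ (fun _ => 0) t₀ n = 0 := by
  simp [jet₁]

lemma jet₂_zero (x₀ y₀ : ℝ) (m n : ℕ) : jet₂ (fun _ => 0) x₀ y₀ m n = 0 := by
  simp [jet₂]

/-- A consistent scheme nearly annihilates the solutions of the homogeneous problem. -/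
lemma FourPointScheme.Consistent.isBigO {S : FourPointScheme} {l : Filter ℝ}
    {x₀ y₀ r s a₀ α₀ : ℝ} {p : ℕ} {E Ex Exx Ey Eyy : ℝ → ℝ → ℝ}
    (hS : S.Consistent ⊤ l x₀ y₀ r s (fun _ => a₀) (fun _ => α₀) p)
    (hE : ∀ n : WithTop ℕ∞, ContDiff ℝ n fun z : ℝ × ℝ => E z.1 z.2)
    (hx : ∀ x y, HasDerivAt (fun t => E t y) (Ex x y) x)
    (hxx : ∀ x y, HasDerivAt (fun t => Ex t y) (Exx x y) x)
    (hy : ∀ x y, HasDerivAt (fun t => E x t) (Ey x y) y)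
    (hyy : ∀ x y, HasDerivAt (fun t => Ey x t) (Eyy x y) y)
    (hΔ : ∀ x y, Exx x y + Eyy x y = 0) (hR : ∀ y, Ex 0 y = α₀ * E 0 y) (hN : ∀ x, Ey x 0 = 0) :
    (fun h => S.C 0 0 h * E 0 0 + S.C 0 1 h * E 0 h + S.C 1 0 h * E h 0 + S.C 1 1 h * E h h)
      =O[l] fun h => h ^ (p + 1) := by
  refine (hS _ _ _ _ (solution_of_harmonic x₀ y₀ r s a₀ α₀ hE hx hxx hy hyy hΔ hR hN)).congr_left
    fun h => ?_
  simp [FourPointScheme.lhs, FourPointScheme.rhs, jet₁_zero, jet₂_zero, Fin.sum_univ_two,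
    add_assoc]

/-- Four numbers that nearly annihilate, relative to `h ^ 8`, the values at the grid points of the
homogeneous solutions with leading parts of degrees `0`, `2`, `4`, `6` are small. -/
lemma coefficients_small {α : ℝ} (hα : α ≠ 0) {K δ : ℝ} (hK : 0 ≤ K) (hδ : 0 < δ) :
    ∃ h₀ > 0, ∀ h, 0 < h → h < h₀ → ∀ A B C D : ℝ,
      |A + B + C * (1 + α * h) + D * (1 + α * h)| ≤ K * h ^ 8 →
      |B * (h ^ 2 / 2) + C * (-h ^ 2 / 2 - α * h ^ 3 / 6) + D * (α * h ^ 3 / 3)| ≤ K * h ^ 8 →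
      |B * (h ^ 4 / 24) + C * (h ^ 4 / 24 + α * h ^ 5 / 120)
        + D * (-h ^ 4 / 6 - α * h ^ 5 / 30)| ≤ K * h ^ 8 →
      |B * (h ^ 6 / 720) + C * (-h ^ 6 / 720 - α * h ^ 7 / 5040)
        + D * (-α * h ^ 7 / 630)| ≤ K * h ^ 8 →
      |A| < δ ∧ |B| < δ ∧ |C| < δ ∧ |D| < δ := by
  have hα' : 0 < |α| := abs_pos.2 hα
  set K' : ℝ := 15162 * K / |α| + 24 * K with hK'
  have hK'0 : 0 ≤ K' := by positivity
  -- Below, the largest coefficient m satisfies m ≤ 9(K' + 2|α|m)h. The bound 1/(36|α|) lets 18|α|mh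
  -- be absorbed into m/2, and then m ≤ 18K'h, which the last bound makes smaller than δ.
  refine ⟨min 1 (min (1 / (36 * |α|)) (δ / (18 * K' + 1))), by positivity,
    fun h h0 hh A B C D e0 e2 e4 e6 => ?_⟩
  have h1 : h ≤ 1 := (hh.le.trans (min_le_left _ _))
  have h2 : h * (36 * |α|) ≤ 1 :=
    (le_div_iff₀ (by positivity)).1 (hh.le.trans ((min_le_right _ _).trans (min_le_left _ _)))
  have h3 : h * (18 * K' + 1) < δ :=
    (lt_div_iff₀ (by positivity)).1 (hh.trans_le ((min_le_right _ _).trans (min_le_right _ _)))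
  have scale : ∀ (n : ℕ) (x : ℝ), n ≤ 8 → |h ^ n * x| ≤ K * h ^ 8 → |x| ≤ K * h ^ (8 - n) := by
    intro n x hn hx
    have hp : 0 < h ^ n := pow_pos h0 n
    rw [abs_mul, abs_of_pos hp, show K * h ^ 8 = h ^ n * (K * h ^ (8 - n)) by
      rw [mul_left_comm, ← pow_add, Nat.add_sub_cancel' hn]] at hx
    exact le_of_mul_le_mul_left hx hp
  have small : ∀ n : ℕ, n ≠ 0 → K * h ^ n ≤ K * h := fun n hn =>
    mul_le_mul_of_nonneg_left (pow_le_of_le_one h0.le h1 hn) hK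
  obtain ⟨m, hA, hB, hC, hD, hm⟩ : ∃ m, |A| ≤ m ∧ |B| ≤ m ∧ |C| ≤ m ∧ |D| ≤ m ∧
      (m = |A| ∨ m = |B| ∨ m = |C| ∨ m = |D|) := by
    refine ⟨max (max |A| |B|) (max |C| |D|), by simp, by simp, by simp, by simp, ?_⟩
    rcases max_choice (max |A| |B|) (max |C| |D|) with e | e <;> rw [e]
    · rcases max_choice |A| |B| with e | e <;> simp [e]
    · rcases max_choice |C| |D| with e | e <;> simp [e]
  have hm0 : 0 ≤ m := (abs_nonneg A).trans hA
  have f2 : |B / 2 - C * (1 / 2 + α * h / 6) + D * (α * h / 3)| ≤ K * h ^ 6 :=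
    scale 2 _ (by norm_num) (by convert e2 using 2; ring)
  have f4 : |B / 24 + C * (1 / 24 + α * h / 120) - D * (1 / 6 + α * h / 30)| ≤ K * h ^ 4 :=
    scale 4 _ (by norm_num) (by convert e4 using 2; ring)
  have f6 : |B / 720 - C * (1 / 720 + α * h / 5040) - D * (α * h / 630)| ≤ K * h ^ 2 :=
    scale 6 _ (by norm_num) (by convert e6 using 2; ring)
  -- The common error of all rows at leading order: the right-hand sides contribute K'h, and terms
  -- of the form αh times a coefficient at most 2|α|mh.
  set T : ℝ := (K' + 2 * |α| * m) * h with hT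
  have prod : ∀ X : ℝ, |X| ≤ m → |α * h * X| ≤ |α| * m * h := by
    intro X hX
    rw [abs_mul, abs_mul, abs_of_pos h0, mul_right_comm]
    exact mul_le_mul_of_nonneg_right (mul_le_mul_of_nonneg_left hX hα'.le) h0.le
  have pC := abs_le.1 (prod C hC)
  have pD := abs_le.1 (prod D hD)
  have hKh : 24 * (K * h) ≤ K' * h := by
    rw [hK', add_mul]
    have : 0 ≤ 15162 * K / |α| * h := by positivity
    linarith
  have hKh0 : 0 ≤ K * h := by positivity
  have hT' : T = K' * h + 2 * (|α| * m * h) := by rw [hT]; ring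
  have hmh : 0 ≤ |α| * m * h := by positivity
  have t1 : |4 * C - 38 * D| ≤ T := by
    -- 21 (720 · row 6 - 2 · row 2): the leading parts cancel, and 15162 = 21 · (720 + 2). Division
    -- by |α|h still leaves a bound of order h; with h^7 in place of h^8 it would only be bounded.
    have g1 : |α * h * (4 * C - 38 * D)| ≤ 15162 * (K * h ^ 2) := by
      have g2 := abs_le.1 f2
      have g6 := abs_le.1 f6
      have g3 : K * h ^ 6 ≤ K * h ^ 2 :=
        mul_le_mul_of_nonneg_left (pow_le_pow_of_le_one h0.le h1 (by norm_num)) hK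
      rw [abs_le]
      constructor <;> linarith
    rw [abs_mul, abs_mul, abs_of_pos h0] at g1
    have g4 : |4 * C - 38 * D| ≤ 15162 * K / |α| * h := by
      rw [div_mul_eq_mul_div, le_div_iff₀ hα']
      refine le_of_mul_le_mul_left ?_ h0
      linarith
    have g5 : 15162 * K / |α| * h ≤ K' * h :=
      mul_le_mul_of_nonneg_right (by rw [hK']; linarith) h0.le
    linarith
  have t2 : |B - C| ≤ T := by
    have g := abs_le.1 f2
    have g' := small 6 (by norm_num)
    rw [abs_le]
    constructor <;> linarith
  have t4 : |B + C - 4 * D| ≤ T := by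
    have g := abs_le.1 f4
    have g' := small 4 (by norm_num)
    rw [abs_le]
    constructor <;> linarith
  have t0 : |A + B + C + D| ≤ T := by
    have g := abs_le.1 e0
    have g' := small 8 (by norm_num)
    rw [abs_le]
    constructor <;> linarith
  rw [abs_le] at t0 t1 t2 t4
  -- `t2` and `t4` give C ≈ 2D, so that 4C - 38D ≈ -30D and `t1` forces D to be small; the other
  -- coefficients follow.
  have bD : |D| ≤ T := abs_le.2 ⟨by linarith, by linarith⟩
  have bC : |C| ≤ 4 * T := by
    have := abs_le.1 bD
    exact abs_le.2 ⟨by linarith, by linarith⟩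
  have bB : |B| ≤ 5 * T := by
    have := abs_le.1 bC
    exact abs_le.2 ⟨by linarith, by linarith⟩
  have bA : |A| ≤ 9 * T := by
    have := abs_le.1 bD
    exact abs_le.2 ⟨by linarith, by linarith⟩
  have hT0 : 0 ≤ T := by positivity
  have hm9 : m ≤ 9 * T := by
    rcases hm with e | e | e | e <;> rw [e] <;> linarith
  have hmδ : m < δ := by
    have g1 : h * (36 * |α|) * m ≤ 1 * m := mul_le_mul_of_nonneg_right h2 hm0
    linarith
  exact ⟨hA.trans_lt hmδ, hB.trans_lt hmδ, hC.trans_lt hmδ, hD.trans_lt hmδ⟩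

/-- The scheme is tested on four polynomial solutions with zero data, for which no choice of
right-hand side can help. -/
theorem not_attainsOrder {x₀ y₀ r s : ℝ} {l : Filter ℝ} [l.NeBot] (hl : l ≤ 𝓝[>] 0) {a₀ α : ℝ}
    (hα : α ≠ 0) {p : ℕ} (hp : 7 ≤ p) :
    ¬AttainsOrder l x₀ y₀ r s (fun _ => a₀) (fun _ => α) p := by
  rintro ⟨S, ⟨δ, hδ, hnd⟩, hS⟩
  have hl0 : l ≤ 𝓝 0 := hl.trans nhdsWithin_le_nhds
  have hpos : ∀ᶠ h in l, 0 < h := hl self_mem_nhdsWithin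
  have hpow : (fun h : ℝ => h ^ (p + 1)) =O[l] fun h => h ^ 8 := by
    refine IsBigO.of_bound 1 ?_
    filter_upwards [hpos, hl0 (Iio_mem_nhds one_pos)] with h h0 h1
    rw [one_mul, Real.norm_eq_abs, Real.norm_eq_abs, abs_of_pos (pow_pos h0 _),
      abs_of_pos (pow_pos h0 _)]
    exact pow_le_pow_of_le_one h0.le (le_of_lt h1) (by omega)
  have d : ∀ (n : ℕ) (x : ℝ), HasDerivAt (fun t : ℝ => t ^ n) (n * x ^ (n - 1)) x :=
    fun n x => hasDerivAt_pow n x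
  -- The test functions are H_n + α ∫₀ˣ H_n for n = 0, 2, 4, 6. The integral is harmonic because
  -- ∂ₓH_n vanishes at x = 0; this also gives the Robin condition, and evenness in y gives the
  -- Neumann condition.
  have s0 := (hS.isBigO (E := fun x _ => 1 + α * x) (Ex := fun _ _ => α) (Exx := fun _ _ => 0) (Ey := fun _ _ => 0) (Eyy := fun _ _ => 0)
    (fun n => by fun_prop)
    (fun x y => by simpa using ((hasDerivAt_id' x).const_mul α).const_add 1)
    (fun x y => hasDerivAt_const _ _) (fun x y => hasDerivAt_const _ _)
    (fun x y => hasDerivAt_const _ _) (by simp) (by simp) (by simp)).trans hpow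
  have s2 := (hS.isBigO (E := fun x y => y ^ 2 / 2 - x ^ 2 / 2 + α * (x * y ^ 2 / 2 - x ^ 3 / 6))
    (Ex := fun x y => -x + α * (y ^ 2 / 2 - x ^ 2 / 2)) (Exx := fun x y => -1 - α * x)
    (Ey := fun x y => y + α * (x * y)) (Eyy := fun x y => 1 + α * x)
    (fun n => by fun_prop)
    (fun x y => by
      have h := ((d 2 x).neg.div_const 2).const_add (y ^ 2 / 2) |>.add
        ((((hasDerivAt_id x).mul_const (y ^ 2 / 2)).sub ((d 3 x).div_const 6)).const_mul α)
      refine (h.congr_deriv ?_).congr_of_eventuallyEq (.of_forall fun t => ?_)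
      · norm_num; ring
      · simp; ring)
    (fun x y => by
      have h := (hasDerivAt_id x).neg.add
        ((((d 2 x).div_const 2).const_sub (y ^ 2 / 2)).const_mul α)
      refine (h.congr_deriv ?_).congr_of_eventuallyEq (.of_forall fun t => ?_)
      · norm_num; ring
      · simp)
    (fun x y => by
      have h := ((d 2 y).mul_const (1 / 2 + α * x / 2)).add_const
        (-x ^ 2 / 2 - α * x ^ 3 / 6)
      refine (h.congr_deriv ?_).congr_of_eventuallyEq (.of_forall fun t => ?_)
      · norm_num; ring
      · simp; ring)
    (fun x y => by
      have h := (hasDerivAt_id y).mul_const (1 + α * x)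
      refine (h.congr_deriv ?_).congr_of_eventuallyEq (.of_forall fun t => ?_)
      · norm_num
      · simp; ring)
    (fun x y => by ring) (fun y => by ring) (fun x => by ring)).trans hpow
  have s4 := (hS.isBigO (E := fun x y => y ^ 4 / 24 - x ^ 2 * y ^ 2 / 4 + x ^ 4 / 24
      + α * (x * y ^ 4 / 24 - x ^ 3 * y ^ 2 / 12 + x ^ 5 / 120))
    (Ex := fun x y => -x * y ^ 2 / 2 + x ^ 3 / 6
      + α * (y ^ 4 / 24 - x ^ 2 * y ^ 2 / 4 + x ^ 4 / 24))
    (Exx := fun x y => -y ^ 2 / 2 + x ^ 2 / 2 + α * (-x * y ^ 2 / 2 + x ^ 3 / 6))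
    (Ey := fun x y => y ^ 3 / 6 - x ^ 2 * y / 2 + α * (x * y ^ 3 / 6 - x ^ 3 * y / 6))
    (Eyy := fun x y => y ^ 2 / 2 - x ^ 2 / 2 + α * (x * y ^ 2 / 2 - x ^ 3 / 6))
    (fun n => by fun_prop)
    (fun x y => by
      have h := (((hasDerivAt_id x).mul_const (α * y ^ 4 / 24)).add
        ((d 2 x).mul_const (-y ^ 2 / 4))).add (((d 3 x).mul_const (-α * y ^ 2 / 12)).add
        (((d 4 x).div_const 24).add ((d 5 x).mul_const (α / 120)))) |>.const_add (y ^ 4 / 24)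
      refine (h.congr_deriv ?_).congr_of_eventuallyEq (.of_forall fun t => ?_)
      · norm_num; ring
      · simp; ring)
    (fun x y => by
      have h := (((hasDerivAt_id x).mul_const (-y ^ 2 / 2)).add
        ((d 2 x).mul_const (-α * y ^ 2 / 4))).add (((d 3 x).div_const 6).add
        ((d 4 x).mul_const (α / 24))) |>.const_add (α * y ^ 4 / 24)
      refine (h.congr_deriv ?_).congr_of_eventuallyEq (.of_forall fun t => ?_)
      · norm_num; ring
      · simp; ring)
    (fun x y => by
      have h := ((d 2 y).mul_const (-x ^ 2 / 4 - α * x ^ 3 / 12)).add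
        ((d 4 y).mul_const (1 / 24 + α * x / 24)) |>.const_add (x ^ 4 / 24 + α * x ^ 5 / 120)
      refine (h.congr_deriv ?_).congr_of_eventuallyEq (.of_forall fun t => ?_)
      · norm_num; ring
      · simp; ring)
    (fun x y => by
      have h := ((hasDerivAt_id y).mul_const (-x ^ 2 / 2 - α * x ^ 3 / 6)).add
        ((d 3 y).mul_const (1 / 6 + α * x / 6))
      refine (h.congr_deriv ?_).congr_of_eventuallyEq (.of_forall fun t => ?_)
      · norm_num; ring
      · simp; ring)
    (fun x y => by ring) (fun y => by ring) (fun x => by ring)).trans hpow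
  have s6 := (hS.isBigO (E := fun x y => y ^ 6 / 720 - x ^ 2 * y ^ 4 / 48 + x ^ 4 * y ^ 2 / 48
      - x ^ 6 / 720 + α * (x * y ^ 6 / 720 - x ^ 3 * y ^ 4 / 144 + x ^ 5 * y ^ 2 / 240
      - x ^ 7 / 5040))
    (Ex := fun x y => -x * y ^ 4 / 24 + x ^ 3 * y ^ 2 / 12 - x ^ 5 / 120
      + α * (y ^ 6 / 720 - x ^ 2 * y ^ 4 / 48 + x ^ 4 * y ^ 2 / 48 - x ^ 6 / 720))
    (Exx := fun x y => -y ^ 4 / 24 + x ^ 2 * y ^ 2 / 4 - x ^ 4 / 24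
      + α * (-x * y ^ 4 / 24 + x ^ 3 * y ^ 2 / 12 - x ^ 5 / 120))
    (Ey := fun x y => y ^ 5 / 120 - x ^ 2 * y ^ 3 / 12 + x ^ 4 * y / 24
      + α * (x * y ^ 5 / 120 - x ^ 3 * y ^ 3 / 36 + x ^ 5 * y / 120))
    (Eyy := fun x y => y ^ 4 / 24 - x ^ 2 * y ^ 2 / 4 + x ^ 4 / 24
      + α * (x * y ^ 4 / 24 - x ^ 3 * y ^ 2 / 12 + x ^ 5 / 120))
    (fun n => by fun_prop)
    (fun x y => by
      have h := ((((hasDerivAt_id x).mul_const (α * y ^ 6 / 720)).add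
        ((d 2 x).mul_const (-y ^ 4 / 48))).add (((d 3 x).mul_const (-α * y ^ 4 / 144)).add
        ((d 4 x).mul_const (y ^ 2 / 48)))).add (((d 5 x).mul_const (α * y ^ 2 / 240)).add
        (((d 6 x).mul_const (-1 / 720)).add ((d 7 x).mul_const (-α / 5040))))
        |>.const_add (y ^ 6 / 720)
      refine (h.congr_deriv ?_).congr_of_eventuallyEq (.of_forall fun t => ?_)
      · norm_num; ring
      · simp; ring)
    (fun x y => by
      have h := ((((hasDerivAt_id x).mul_const (-y ^ 4 / 24)).add
        ((d 2 x).mul_const (-α * y ^ 4 / 48))).add (((d 3 x).mul_const (y ^ 2 / 12)).add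
        ((d 4 x).mul_const (α * y ^ 2 / 48)))).add (((d 5 x).mul_const (-1 / 120)).add
        ((d 6 x).mul_const (-α / 720))) |>.const_add (α * y ^ 6 / 720)
      refine (h.congr_deriv ?_).congr_of_eventuallyEq (.of_forall fun t => ?_)
      · norm_num; ring
      · simp; ring)
    (fun x y => by
      have h := (((d 2 y).mul_const (x ^ 4 / 48 + α * x ^ 5 / 240)).add
        ((d 4 y).mul_const (-x ^ 2 / 48 - α * x ^ 3 / 144))).add
        ((d 6 y).mul_const (1 / 720 + α * x / 720))
        |>.const_add (-x ^ 6 / 720 - α * x ^ 7 / 5040)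
      refine (h.congr_deriv ?_).congr_of_eventuallyEq (.of_forall fun t => ?_)
      · norm_num; ring
      · simp; ring)
    (fun x y => by
      have h := (((hasDerivAt_id y).mul_const (x ^ 4 / 24 + α * x ^ 5 / 120)).add
        ((d 3 y).mul_const (-x ^ 2 / 12 - α * x ^ 3 / 36))).add
        ((d 5 y).mul_const (1 / 120 + α * x / 120))
      refine (h.congr_deriv ?_).congr_of_eventuallyEq (.of_forall fun t => ?_)
      · norm_num; ring
      · simp; ring)
    (fun x y => by ring) (fun y => by ring) (fun x => by ring)).trans hpow
  obtain ⟨K0, b0⟩ := s0.bound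
  obtain ⟨K2, b2⟩ := s2.bound
  obtain ⟨K4, b4⟩ := s4.bound
  obtain ⟨K6, b6⟩ := s6.bound
  set K := |K0| + |K2| + |K4| + |K6|
  have hK0 : K0 ≤ K := by
    linarith [le_abs_self K0, abs_nonneg K2, abs_nonneg K4, abs_nonneg K6]
  have hK2 : K2 ≤ K := by
    linarith [le_abs_self K2, abs_nonneg K0, abs_nonneg K4, abs_nonneg K6]
  have hK4 : K4 ≤ K := by
    linarith [le_abs_self K4, abs_nonneg K2, abs_nonneg K0, abs_nonneg K6]
  have hK6 : K6 ≤ K := by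
    linarith [le_abs_self K6, abs_nonneg K2, abs_nonneg K4, abs_nonneg K0]
  obtain ⟨h₀, hh₀, H⟩ := coefficients_small hα (K := K) (by positivity) hδ
  have hlt' : ∀ᶠ h in l, h < h₀ := hl0 (Iio_mem_nhds hh₀)
  -- As `l` is nontrivial, some mesh size satisfies all the bounds at once; there every coefficient
  -- is below δ, although one of them is at least δ.
  obtain ⟨h, h0, hlt, ⟨k, ℓ, hkl⟩, c0, c2, c4, c6⟩ := (hpos.and (hlt'.and
    (hnd.and (b0.and (b2.and (b4.and b6)))))).exists
  have up : ∀ {x y k : ℝ}, ‖x‖ ≤ k * ‖h ^ 8‖ → k ≤ K → x = y → |y| ≤ K * h ^ 8 := by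
    intro x y k hx hk hxy
    rw [← hxy, ← Real.norm_eq_abs]
    refine hx.trans ?_
    rw [Real.norm_eq_abs, abs_of_pos (pow_pos h0 8)]
    exact mul_le_mul_of_nonneg_right hk (by positivity)
  obtain ⟨q00, q01, q10, q11⟩ := H h h0 hlt (S.C 0 0 h) (S.C 0 1 h) (S.C 1 0 h) (S.C 1 1 h)
    (up c0 hK0 (by ring)) (up c2 hK2 (by ring)) (up c4 hK4 (by ring)) (up c6 hK6 (by ring))
  fin_cases k <;> fin_cases ℓ
  · exact absurd hkl (not_le.2 q00)
  · exact absurd hkl (not_le.2 q01)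
  · exact absurd hkl (not_le.2 q10)
  · exact absurd hkl (not_le.2 q11)

/-! ### The order of the corner scheme -/

theorem attainsOrder_six {x₀ y₀ r s : ℝ} (hr : 0 < r) (hs : 0 < s) {l : Filter ℝ}
    (hl : l ≤ 𝓝[>] 0) {a : ℝ × ℝ → ℝ} {α : ℝ → ℝ} (hc : Coefficients ⊤ x₀ y₀ r s a α) :
    AttainsOrder l x₀ y₀ r s a α 6 := by
  have hA : jet₂ a x₀ y₀ 0 0 ≠ 0 := by
    simpa [jet₂] using (hc.a_pos _ (corner_mem hr hs)).ne'
  obtain ⟨c, hc1, hsys⟩ := exists_solvesSystem hA (jet₁ α y₀)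
  exact ⟨cornerScheme (jet₂ a x₀ y₀) (jet₁ α y₀) c,
    cornerScheme_nondegenerate hl _ _ ⟨1, 1, by rw [hc1]; exact one_ne_zero⟩,
    fun u f g₁ g₃ hu => cornerScheme_consistent hr hs hl (hc.mono le_top) hsys u f g₁ g₃
      (hu.mono le_top)⟩

lemma coefficients_const (x₀ y₀ r s : ℝ) {a₀ : ℝ} (ha : 0 < a₀) (α₀ : ℝ) :
    Coefficients ⊤ x₀ y₀ r s (fun _ => a₀) (fun _ => α₀) :=
  ⟨contDiffOn_const, contDiffOn_const, fun _ _ => ha⟩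

end CornerFD

theorem theorem2p5 (x₀ y₀ r s : ℝ) (hr : 0 < r) (hs : 0 < s)
    (l : Filter ℝ) [l.NeBot] (hl : l ≤ 𝓝[>] 0) :
    -- the constructed scheme exists and is of order six
    (∀ (a : ℝ × ℝ → ℝ) (α : ℝ → ℝ), CornerFD.Coefficients 5 x₀ y₀ r s a α →
      (∃ c : Fin 2 → Fin 2 → Fin 7 → ℝ, c 1 1 0 = 1 ∧
        CornerFD.SolvesSystem (CornerFD.jet₂ a x₀ y₀) (CornerFD.jet₁ α y₀) c) ∧
      ∀ c : Fin 2 → Fin 2 → Fin 7 → ℝ,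
        CornerFD.SolvesSystem (CornerFD.jet₂ a x₀ y₀) (CornerFD.jet₁ α y₀) c →
        (CornerFD.cornerScheme (CornerFD.jet₂ a x₀ y₀) (CornerFD.jet₁ α y₀) c).Consistent
            5 l x₀ y₀ r s a α 6 ∧
        ((∃ k ℓ, c k ℓ 0 ≠ 0) →
          (CornerFD.cornerScheme (CornerFD.jet₂ a x₀ y₀) (CornerFD.jet₁ α y₀) c).Nondegenerate l)) ∧
    -- six is the largest order available for all smooth `a` and `α`
    IsGreatest {p : ℕ | ∀ (a : ℝ × ℝ → ℝ) (α : ℝ → ℝ), CornerFD.Coefficients ⊤ x₀ y₀ r s a α →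
      CornerFD.AttainsOrder l x₀ y₀ r s a α p} 6 ∧
    -- and already for each constant `a > 0` and each constant `α ≠ 0`
    (∀ a₀ α₀ : ℝ, 0 < a₀ → α₀ ≠ 0 →
      IsGreatest {p : ℕ | CornerFD.AttainsOrder l x₀ y₀ r s (fun _ => a₀) (fun _ => α₀) p} 6) := by
  refine ⟨fun a α hc => ⟨CornerFD.exists_solvesSystem ?_ _, fun c hsys =>
    ⟨CornerFD.cornerScheme_consistent hr hs hl hc hsys,
      CornerFD.cornerScheme_nondegenerate hl _ _⟩⟩, ⟨fun a α hc =>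
        CornerFD.attainsOrder_six hr hs hl hc, fun p hp => ?_⟩, fun a₀ α₀ ha hα =>
          ⟨CornerFD.attainsOrder_six hr hs hl (CornerFD.coefficients_const x₀ y₀ r s ha α₀),
            fun p hp => ?_⟩⟩
  · simpa [CornerFD.jet₂] using (hc.a_pos _ (CornerFD.corner_mem hr hs)).ne'
  -- A single problem refutes order seven for the whole class: a = 1, α = 1.
  · by_contra h
    exact CornerFD.not_attainsOrder hl one_ne_zero (by omega : 7 ≤ p)
      (hp _ _ (CornerFD.coefficients_const x₀ y₀ r s one_pos 1))
  · by_contra h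
    exact CornerFD.not_attainsOrder hl hα (by omega : 7 ≤ p) hp
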